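/- Let $X$ be a separable real Hilbert space and let $\gamma=\mathcal N(0,Q)$ be a centered Gaussian Borel probability measure on $X$ with covariance operator $Q$, nondegenerate in the sense that $\operatorname{Ker}Q=\{0\}$; $Q^{1/2}$ is the nonnegative square root of $Q$. Let $j:X^*\to L^2(X,\gamma)$, $j(f)=f-\int_X f\,d\gamma$, let $X^*_\gamma$ be the closure of $j(X^*)$ in $L^2(X,\gamma)$, and let $H=\{h\in X:\|h\|_H<\infty\}$, $\|h\|_H=\sup\{f(h): f\in X^*,\ \|j(f)\|_{L^2(X,\gamma)}\le 1\}$, be the Cameron–Martin space, a Hilbert space with $\langle h,k\rangle_H=\langle\hat h,\hat k\rangle_{L^2(X,\gamma)}$, where $h\mapsto\hat h$ is the inverse of the unitary operator $R_\gamma:X^*_\gamma\to H$, $R_\gamma g=\int_X g(x)\,x\,\gamma(dx)$. Let $\mathcal W_\bullet:X\to X_\gamma^*$ be the white noise map, i.e. the continuous linear extension of $Q^{1/2}y\mapsto\langle y,\cdot\rangle_X$. For $\varphi\in C^1(X)$, $\nabla\varphi(x)\in X$ is the gradient and $\nabla_H\varphi(x)\in H$ is the Riesz representative in $H$ of the Fréchet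 derivative at $0$ of $H\ni h\mapsto\varphi(x+h)$. Let $C^1_b(X)$ be the space of bounded $C^1$ functions with bounded derivative. Then: 1. $\|\nabla_H\varphi(x)\|_H=\|Q^{1/2}\nabla\varphi(x)\|_X$ for all $\varphi\in C^1(X)$ and $x\in X$. 2. Let $1\le p<\infty$. The operators $\nabla_H:C^1_b(X)\to L^p(X,\gamma;H)$ and $Q^{1/2}\nabla:C^1_b(X)\to L^p(X,\gamma;X)$ are well defined and closable as unbounded operators on $L^p(X,\gamma)$. Denote their closures by $\nabla_H$ and $M$, with domains $W^{1,p}$ and $W^{1,p}_{Q^{1/2}}$. Then $W^{1,p}=W^{1,p}_{Q^{1/2}}$, and for every $F$ in this space $\nabla_HF=Q^{1/2}MF$ $\gamma$-a.e. and $\|\nabla_HF\|_{L^p(X,\gamma;H)}=\|MF\|_{L^p(X,\gamma;X)}$. If $X$ is infinite dimensional, the two operators are different: there is $F\in W^{1,p}$ for which $\nabla_HF$ and $MF$, both regarded as $X$-valued via $H\subset X$, are not $\gamma$-a.e. equal. 3. Let $\mathcal H$ be a real Hilbert space and $W:\mathcal H\to X^*_\gamma$ a unitary operator. The operator $q(W(h_1),\dots,W(h_m))\mapsto\sum_{i=1}^m\partial_iq(W(h_1),\dots,W(h_m))\,h_i$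 on polynomials in elements of $X^*_\gamma$ is well defined and closable from $L^2(X,\gamma)$ to $L^2(X,\gamma;\mathcal H)$, and the domain $\mathbb D^{1,2}$ of its closure satisfies $\mathbb D^{1,2}=W^{1,2}=W^{1,2}_{Q^{1/2}}$. 4. For $p=2$: $\nabla_H\hat h=h$ for all $h\in H$ and $M\mathcal W_z=z$ for all $z\in X$. -/

import Mathlib

open MeasureTheory ProbabilityTheory
open scoped ENNReal Gradient

universe u v

set_option linter.unusedSectionVars false

noncomputable section

namespace GaussMalliavin

section SquareRoot

/-! ### The nonnegative square root of a nonnegative operator on a real Hilbert space -/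

theorem catalan_partial_sum (N : ℕ) :
    ∑ n ∈ Finset.range N, (catalan n : ℝ) / 4 ^ n = 2 - 2 * (N.centralBinom : ℝ) / 4 ^ N := by
  induction N with
  | zero => simp
  | succ k ih =>
    have h1 : ((k : ℝ) + 1) * catalan k = k.centralBinom := by
      exact_mod_cast succ_mul_catalan_eq_centralBinom k
    have h2 : ((k : ℝ) + 1) * (k + 1).centralBinom = 2 * (2 * k + 1) * k.centralBinom := by
      exact_mod_cast Nat.succ_mul_centralBinom_succ k
    have hk : (k : ℝ) + 1 ≠ 0 := by positivity
    rw [Finset.sum_range_succ, ih]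
    have h3 : (((k + 1).centralBinom : ℕ) : ℝ) = 2 * (2 * k + 1) * catalan k := by
      apply mul_left_cancel₀ hk
      rw [h2, ← h1]; ring
    rw [h3, ← h1, pow_succ]
    field_simp
    ring

theorem catalan_summable : Summable (fun n : ℕ => (catalan n : ℝ) / 4 ^ n) := by
  refine summable_of_sum_range_le (c := 2) (fun n => by positivity) (fun N => ?_)
  rw [catalan_partial_sum]
  have : 0 ≤ 2 * (N.centralBinom : ℝ) / 4 ^ N := by positivity
  linarith

theorem catalan_tsum_le : ∑' n : ℕ, (catalan n : ℝ) / 4 ^ n ≤ 2 := by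
  refine Real.tsum_le_of_sum_range_le (fun n => by positivity) (fun N => ?_)
  rw [catalan_partial_sum]
  have : 0 ≤ 2 * (N.centralBinom : ℝ) / 4 ^ N := by positivity
  linarith

variable {X : Type u} [NormedAddCommGroup X] [InnerProductSpace ℝ X] [CompleteSpace X]

theorem norm_le_one_of_pos {A : X →L[ℝ] X} (hA : A.IsPositive)
    (hA1 : (1 - A : X →L[ℝ] X).IsPositive) : ‖A‖ ≤ 1 := by
  refine ContinuousLinearMap.opNorm_le_bound _ zero_le_one fun x => ?_
  rw [one_mul]
  have hs : ∀ x y, inner ℝ (A x) y = inner ℝ x (A y) := fun x y => hA.isSymmetric x y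
  have p1 := hA.inner_nonneg_left ((1 - A) x)
  have p2 := hA1.inner_nonneg_left (A x)
  have p3 := hA1.inner_nonneg_left x
  simp only [sub_apply, one_apply_eq_self, map_sub,
    inner_sub_left, inner_sub_right] at p1 p2 p3
  have e1 : inner ℝ (A (A x)) x = inner ℝ (A x) (A x) := hs _ _
  have e2 : inner ℝ (A (A x)) (A x) = inner ℝ (A x) (A (A x)) := hs _ _
  have h : inner ℝ (A x) (A x) ≤ inner ℝ x x := by
    linarith
  rw [real_inner_self_eq_norm_sq, real_inner_self_eq_norm_sq] at h
  exact le_of_sq_le_sq h (norm_nonneg x)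

theorem exists_sqrt_of_le_one {Q : X →L[ℝ] X} (hQ : Q.IsPositive)
    (hQ1 : (1 - Q : X →L[ℝ] X).IsPositive) :
    ∃ S : X →L[ℝ] X, S.IsPositive ∧ S ∘L S = Q := by
  -- `S = 1 - (A / 2) * B` with `A = 1 - Q` and `B` the generating series of the Catalan numbers
  set A : X →L[ℝ] X := 1 - Q with hA
  have hQA : 1 - A = Q := by rw [hA]; abel
  have hA1 : ‖A‖ ≤ 1 := norm_le_one_of_pos hQ1 (by rw [hQA]; exact hQ)
  set u : ℕ → (X →L[ℝ] X) := fun n => ((catalan n : ℝ) / 4 ^ n) • A ^ n with hu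
  have hpow : ∀ n : ℕ, ‖A ^ n‖ ≤ 1 := by
    intro n
    induction n with
    | zero =>
      rw [pow_zero]
      exact ContinuousLinearMap.norm_id_le
    | succ k ih =>
      rw [pow_succ]
      calc ‖A ^ k * A‖ ≤ ‖A ^ k‖ * ‖A‖ := norm_mul_le _ _
        _ ≤ 1 * 1 := by gcongr
        _ = 1 := one_mul _
  have hub : ∀ n, ‖u n‖ ≤ (catalan n : ℝ) / 4 ^ n := by
    intro n
    rw [hu]
    simp only [norm_smul]
    rw [Real.norm_of_nonneg (by positivity)]
    exact mul_le_of_le_one_right (by positivity) (hpow n)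
  have hun : Summable (fun n => ‖u n‖) :=
    Summable.of_nonneg_of_le (fun _ => norm_nonneg _) hub catalan_summable
  have hus : Summable u := hun.of_norm
  set B := ∑' n, u n with hB
  have hBn : ‖B‖ ≤ 2 := by
    refine (norm_tsum_le_tsum_norm hun).trans (le_trans ?_ catalan_tsum_le)
    exact hun.tsum_le_tsum hub catalan_summable
  have hAsa : IsSelfAdjoint A := hQ1.isSelfAdjoint
  have husa : ∀ n, IsSelfAdjoint (u n) := fun n => by
    rw [hu]; exact (IsSelfAdjoint.all _).smul (hAsa.pow n)
  have hBsa : IsSelfAdjoint B := by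
    rw [IsSelfAdjoint, hB, tsum_star]
    exact tsum_congr fun n => husa n
  have hcomm : Commute A B := by
    rw [hB]
    refine Commute.tsum_right _ fun n => ?_
    rw [hu]
    exact ((Commute.refl A).pow_right n).smul_right _
  have hBB : B = 1 + (1 / 4 : ℝ) • (A * (B * B)) := by
    have h1 : B * B = ∑' n, ((catalan (n + 1) : ℝ) / 4 ^ n) • A ^ n := by
      rw [hB, tsum_mul_tsum_eq_tsum_sum_antidiagonal_of_summable_norm hun hun]
      refine tsum_congr fun n => ?_
      rw [catalan_succ']
      push_cast
      rw [Finset.sum_div, Finset.sum_smul]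
      refine Finset.sum_congr rfl fun ij hij => ?_
      rw [Finset.HasAntidiagonal.mem_antidiagonal] at hij
      rw [hu]
      simp only [smul_mul_smul_comm, ← pow_add, hij]
      congr 1
      rw [← hij, pow_add]
      field_simp
    have hus' : Summable fun n => ((catalan (n + 1) : ℝ) / 4 ^ n) • A ^ n := by
      have := (summable_nat_add_iff 1).2 catalan_summable
      refine Summable.of_norm_bounded (this.mul_left 4) fun n => ?_
      rw [norm_smul, Real.norm_of_nonneg (by positivity)]
      refine (mul_le_of_le_one_right (by positivity) (hpow n)).trans (le_of_eq ?_)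
      rw [pow_succ]; field_simp
    rw [h1, hus'.tsum_mul_left A |>.symm, ← (hus'.mul_left A).tsum_const_smul]
    rw [hB, hus.tsum_eq_zero_add]
    congr 1
    · rw [hu]; simp
    · refine tsum_congr fun n => ?_
      rw [hu]
      simp only [mul_smul_comm, smul_smul, ← pow_succ']
      congr 1
      rw [pow_succ]; field_simp
  set T : X →L[ℝ] X := (1 / 2 : ℝ) • (A * B) with hT
  have hTsa : IsSelfAdjoint T := by
    rw [hT]
    refine (IsSelfAdjoint.all _).smul ?_
    rw [IsSelfAdjoint, star_mul, hAsa.star_eq, hBsa.star_eq, hcomm.eq]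
  have hTn : ‖T‖ ≤ 1 := by
    rw [hT, norm_smul, Real.norm_of_nonneg (by norm_num)]
    have : ‖A * B‖ ≤ 1 * 2 := (norm_mul_le _ _).trans (by gcongr)
    linarith
  refine ⟨1 - T, ?_, ?_⟩
  · rw [ContinuousLinearMap.isPositive_def']
    refine ⟨(IsSelfAdjoint.one _).sub hTsa, fun x => ?_⟩
    have h1 : inner ℝ (T x) x ≤ ‖x‖ * ‖x‖ := by
      refine (real_inner_le_norm _ _).trans ?_
      gcongr
      exact (T.le_opNorm x).trans (mul_le_of_le_one_left (norm_nonneg _) hTn)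
    have h2 : inner ℝ ((1 - T : X →L[ℝ] X) x) x = ‖x‖ * ‖x‖ - inner ℝ (T x) x := by
      rw [sub_apply, inner_sub_left, one_apply_eq_self, real_inner_self_eq_norm_mul_norm]
    rw [ContinuousLinearMap.reApplyInnerSelf_apply, h2]
    simpa using h1
  · have e : (1 - T) * (1 - T) = Q := by
      have h3 : T * T = (1 / 4 : ℝ) • (A * (A * (B * B))) := by
        rw [hT, smul_mul_smul_comm, mul_assoc, ← mul_assoc B A B, ← hcomm.eq, mul_assoc A B B]
        norm_num
      have h4 : A * B = A + T * T := by
        conv_lhs => rw [hBB]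
        rw [h3, mul_add, mul_one, mul_smul_comm]
      have h5 : T + T = A * B := by
        rw [hT, ← add_smul]; norm_num
      calc (1 - T) * (1 - T) = 1 - (T + T) + T * T := by noncomm_ring
        _ = 1 - A := by rw [h5, h4]; abel
        _ = Q := hQA
    exact e

/-- Every nonnegative bounded operator on a real Hilbert space has a nonnegative square root. -/
theorem exists_sqrt {Q : X →L[ℝ] X} (hQ : Q.IsPositive) :
    ∃ S : X →L[ℝ] X, S.IsPositive ∧ S ∘L S = Q := by
  set c : ℝ := ‖Q‖ + 1 with hc
  have hc0 : 0 < c := by positivity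
  obtain ⟨S, hS, hSS⟩ := exists_sqrt_of_le_one (Q := c⁻¹ • Q)
    (hQ.smul_of_nonneg (inv_nonneg.2 hc0.le)) (by
      rw [ContinuousLinearMap.isPositive_def']
      refine ⟨(IsSelfAdjoint.one _).sub ((IsSelfAdjoint.all _).smul hQ.isSelfAdjoint),
        fun x => ?_⟩
      have h1 : inner ℝ (Q x) x ≤ c * (‖x‖ * ‖x‖) := by
        refine (real_inner_le_norm _ _).trans ?_
        rw [← mul_assoc]
        gcongr
        exact (Q.le_opNorm x).trans (by gcongr; linarith)
      have h2 : inner ℝ ((1 - c⁻¹ • Q : X →L[ℝ] X) x) x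
          = ‖x‖ * ‖x‖ - c⁻¹ * inner ℝ (Q x) x := by
        rw [sub_apply, inner_sub_left, one_apply_eq_self, real_inner_self_eq_norm_mul_norm,
          smul_apply, real_inner_smul_left]
      rw [ContinuousLinearMap.reApplyInnerSelf_apply, h2]
      have h3 : c⁻¹ * inner ℝ (Q x) x ≤ ‖x‖ * ‖x‖ := by
        rw [inv_mul_le_iff₀ hc0]; exact h1
      simpa using h3)
  refine ⟨√c • S, hS.smul_of_nonneg (Real.sqrt_nonneg _), ?_⟩
  rw [ContinuousLinearMap.smul_comp, ContinuousLinearMap.comp_smul, hSS, smul_smul, smul_smul,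
    Real.mul_self_sqrt hc0.le, mul_inv_cancel₀ hc0.ne', one_smul]

/-- `Q^{1/2}`: the (unique) nonnegative bounded operator `S` with `S ∘ S = Q`. -/
def opSqrt (Q : X →L[ℝ] X) (hQ : Q.IsPositive) : X →L[ℝ] X := (exists_sqrt hQ).choose

theorem opSqrt_isPositive (Q : X →L[ℝ] X) (hQ : Q.IsPositive) : (opSqrt Q hQ).IsPositive :=
  (exists_sqrt hQ).choose_spec.1

theorem opSqrt_comp_self (Q : X →L[ℝ] X) (hQ : Q.IsPositive) :
    opSqrt Q hQ ∘L opSqrt Q hQ = Q :=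
  (exists_sqrt hQ).choose_spec.2

end SquareRoot

section CameronMartin

/-! ### The Gaussian Hilbert space and the Cameron-Martin space of a Gaussian measure -/

variable {X : Type u} [NormedAddCommGroup X] [NormedSpace ℝ X] [CompleteSpace X]
  [SecondCountableTopology X] [MeasurableSpace X] [BorelSpace X] (γ : Measure X) [IsGaussian γ]

/-- The map `j : X* → L²(X, γ)`, `j f = f - a_γ(f)`, where `a_γ(f) = f (∫ x, x ∂γ) = ∫ f dγ`. -/
def centeredEmb : StrongDual ℝ X →L[ℝ] Lp ℝ 2 γ :=
  StrongDual.toLp γ 2 -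
    (Lp.constL 2 γ ℝ).comp (NormedSpace.inclusionInDoubleDual ℝ X (∫ x, x ∂γ))

theorem centeredEmb_coe (f : StrongDual ℝ X) :
    centeredEmb γ f =ᵐ[γ] fun x => f x - ∫ y, f y ∂γ := by
  have h1 : StrongDual.toLp γ 2 f =ᵐ[γ] f := by
    rw [StrongDual.toLp_apply IsGaussian.memLp_two_id]
    exact MemLp.coeFn_toLp _
  have h2 := Lp.coeFn_const (p := 2) (μ := γ) (f (∫ x, x ∂γ))
  have h3 : centeredEmb γ f = StrongDual.toLp γ 2 f - Lp.const 2 γ (f (∫ x, x ∂γ)) := rfl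
  rw [h3]
  filter_upwards [Lp.coeFn_sub (StrongDual.toLp γ 2 f) (Lp.const 2 γ (f (∫ x, x ∂γ))), h1, h2]
    with x e1 e2 e3
  rw [e1, Pi.sub_apply, e2, e3, IsGaussian.integral_dual]
  rfl

/-- The Gaussian Hilbert space `X_γ^*`: the closure of `j(X*)` in `L²(X, γ)`. -/
def gaussHilbert : Submodule ℝ (Lp ℝ 2 γ) :=
  (LinearMap.range (centeredEmb γ).toLinearMap).topologicalClosure

instance : CompleteSpace (gaussHilbert γ) :=
  inferInstanceAs (CompleteSpace
    (LinearMap.range (centeredEmb γ).toLinearMap).topologicalClosure)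

/-- `j`, with values in `X_γ^*`. -/
def emb : StrongDual ℝ X →ₗ[ℝ] gaussHilbert γ :=
  (centeredEmb γ).toLinearMap.codRestrict (gaussHilbert γ) fun f =>
    Submodule.le_topologicalClosure _ ⟨f, rfl⟩

theorem emb_coe (f : StrongDual ℝ X) : (emb γ f : Lp ℝ 2 γ) = centeredEmb γ f := rfl

theorem emb_norm (f : StrongDual ℝ X) : ‖emb γ f‖ = ‖centeredEmb γ f‖ := rfl

theorem denseRange_emb : DenseRange (emb γ) := by
  intro g
  rw [Topology.IsInducing.subtypeVal.closure_eq_preimage_closure_image]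
  have h : (Subtype.val '' Set.range (emb γ) : Set (Lp ℝ 2 γ)) =
      (LinearMap.range (centeredEmb γ).toLinearMap : Set (Lp ℝ 2 γ)) := by
    ext y
    constructor
    · rintro ⟨_, ⟨f, rfl⟩, rfl⟩
      exact ⟨f, rfl⟩
    · rintro ⟨f, rfl⟩
      exact ⟨emb γ f, ⟨f, rfl⟩, rfl⟩
  have h2 : (g : Lp ℝ 2 γ) ∈ closure (Subtype.val '' Set.range (emb γ) : Set (Lp ℝ 2 γ)) := by
    simp only [h]
    exact g.2
  exact h2

/-- The set `{f(h) : f ∈ X*, ‖j f‖ ≤ 1}`, whose supremum is the Cameron-Martin norm of `h`. -/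
def cmSet (h : X) : Set ℝ := {r | ∃ f : StrongDual ℝ X, ‖centeredEmb γ f‖ ≤ 1 ∧ r = f h}

theorem abs_le_of_mem_upperBounds {h : X} {C : ℝ} (hC : C ∈ upperBounds (cmSet γ h))
    (f : StrongDual ℝ X) : |f h| ≤ C * ‖centeredEmb γ f‖ := by
  have key : ∀ f : StrongDual ℝ X, f h ≤ C * ‖centeredEmb γ f‖ := by
    intro f
    rcases eq_or_lt_of_le (norm_nonneg (centeredEmb γ f)) with h0 | h0
    · rw [← h0, mul_zero]
      by_contra! hf
      have h1 : ((|C| + 1) / f h) * f h ≤ C := hC ⟨((|C| + 1) / f h) • f, by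
        rw [map_smul, norm_smul, ← h0]; simp, rfl⟩
      rw [div_mul_cancel₀ _ hf.ne'] at h1
      linarith [le_abs_self C]
    · have h1 : ‖centeredEmb γ f‖⁻¹ * f h ≤ C := hC ⟨‖centeredEmb γ f‖⁻¹ • f, by
        rw [map_smul, norm_smul, norm_inv, norm_norm, inv_mul_cancel₀ h0.ne'], rfl⟩
      rw [inv_mul_le_iff₀ h0] at h1
      linarith
  refine abs_le'.2 ⟨key f, ?_⟩
  have := key (-f)
  rwa [map_neg, norm_neg] at this

theorem bddAbove_cmSet_iff (h : X) :
    BddAbove (cmSet γ h) ↔ ∃ C, ∀ f : StrongDual ℝ X, |f h| ≤ C * ‖centeredEmb γ f‖ := by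
  constructor
  · rintro ⟨C, hC⟩
    exact ⟨C, abs_le_of_mem_upperBounds γ hC⟩
  · rintro ⟨C, hC⟩
    refine ⟨|C|, ?_⟩
    rintro _ ⟨f, hf, rfl⟩
    calc f h ≤ |f h| := le_abs_self _
      _ ≤ C * ‖centeredEmb γ f‖ := hC f
      _ ≤ |C| * ‖centeredEmb γ f‖ := by gcongr; exact le_abs_self C
      _ ≤ |C| * 1 := by gcongr
      _ = |C| := mul_one _

/-- The Cameron-Martin space `H = {h ∈ X : ‖h‖_H < ∞}`, as a linear subspace of `X`. -/
def cmSubmodule : Submodule ℝ X where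
  carrier := {h | BddAbove (cmSet γ h)}
  zero_mem' := (bddAbove_cmSet_iff γ 0).2 ⟨0, fun f => by simp⟩
  add_mem' := by
    intro h k hh hk
    obtain ⟨C, hC⟩ := (bddAbove_cmSet_iff γ h).1 hh
    obtain ⟨D, hD⟩ := (bddAbove_cmSet_iff γ k).1 hk
    refine (bddAbove_cmSet_iff γ _).2 ⟨C + D, fun f => ?_⟩
    rw [map_add, add_mul]
    exact (abs_add_le _ _).trans (add_le_add (hC f) (hD f))
  smul_mem' := by
    intro c h hh
    obtain ⟨C, hC⟩ := (bddAbove_cmSet_iff γ h).1 hh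
    refine (bddAbove_cmSet_iff γ _).2 ⟨|c| * C, fun f => ?_⟩
    rw [map_smul, smul_eq_mul, abs_mul, mul_assoc]
    gcongr
    exact hC f

/-- The operator `R_γ : X_γ^* → X`, `R_γ g = ∫ g(x) (x - a) dγ(x)` with `a` the mean of `γ`. -/
def rGammaFun (g : gaussHilbert γ) : X := ∫ x, (g : Lp ℝ 2 γ) x • (x - ∫ y, y ∂γ) ∂γ

theorem rGamma_integrable (g : gaussHilbert γ) :
    Integrable (fun x => (g : Lp ℝ 2 γ) x • (x - ∫ y, y ∂γ)) γ := by
  have h1 : MemLp (fun x : X => x - ∫ y, y ∂γ) 2 γ :=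
    (IsGaussian.memLp_two_id (μ := γ)).sub (memLp_const _)
  exact memLp_one_iff_integrable.1 (h1.smul (Lp.memLp (g : Lp ℝ 2 γ)))

theorem dual_rGammaFun (g : gaussHilbert γ) (f : StrongDual ℝ X) :
    f (rGammaFun γ g) = inner ℝ g (emb γ f) := by
  rw [rGammaFun, ← ContinuousLinearMap.integral_comp_comm _ (rGamma_integrable γ g),
    Submodule.coe_inner, L2.inner_def]
  refine integral_congr_ae ?_
  filter_upwards [centeredEmb_coe γ f] with x hx
  rw [emb_coe, hx, map_smul, map_sub, ← IsGaussian.integral_dual]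
  simp [mul_comm]

theorem rGammaFun_mem (g : gaussHilbert γ) : rGammaFun γ g ∈ cmSubmodule γ := by
  refine (bddAbove_cmSet_iff γ _).2 ⟨‖g‖, fun f => ?_⟩
  rw [dual_rGammaFun]
  exact abs_real_inner_le_norm _ _

theorem eq_of_forall_inner_emb {g g' : gaussHilbert γ}
    (h : ∀ f, inner ℝ g (emb γ f) = inner ℝ g' (emb γ f)) : g = g' :=
  (denseRange_emb γ).eq_of_inner_left ℝ h

/-- `R_γ` as a linear map into the Cameron-Martin space. -/
def rGammaLin : gaussHilbert γ →ₗ[ℝ] cmSubmodule γ where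
  toFun g := ⟨rGammaFun γ g, rGammaFun_mem γ g⟩
  map_add' g g' := by
    refine Subtype.ext ((SeparatingDual.eq_iff_forall_dual_eq (R := ℝ)).2 fun f => ?_)
    simp only [Submodule.coe_add, map_add, dual_rGammaFun, inner_add_left]
  map_smul' c g := by
    refine Subtype.ext ((SeparatingDual.eq_iff_forall_dual_eq (R := ℝ)).2 fun f => ?_)
    simp only [Submodule.coe_smul, map_smul, dual_rGammaFun, real_inner_smul_left, smul_eq_mul,
      RingHom.id_apply]

theorem rGammaLin_bijective : Function.Bijective (rGammaLin γ) := by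
  constructor
  · intro g g' h
    refine eq_of_forall_inner_emb γ fun f => ?_
    rw [← dual_rGammaFun, ← dual_rGammaFun]
    exact congrArg f (congrArg Subtype.val h)
  · rintro ⟨h, hh⟩
    obtain ⟨C, hC⟩ := (bddAbove_cmSet_iff γ h).1 hh
    let ev : StrongDual ℝ X →ₗ[ℝ] ℝ := (NormedSpace.inclusionInDoubleDual ℝ X h).toLinearMap
    let L : gaussHilbert γ →L[ℝ] ℝ := ev.extendOfNorm (emb γ)
    have hL : ∀ f, L (emb γ f) = f h := fun f =>
      LinearMap.extendOfNorm_eq (f := ev) (e := emb γ) (denseRange_emb γ) ⟨C, hC⟩ f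
    refine ⟨(InnerProductSpace.toDual ℝ (gaussHilbert γ)).symm L, Subtype.ext ?_⟩
    refine (SeparatingDual.eq_iff_forall_dual_eq (R := ℝ)).2 fun f => ?_
    change f (rGammaFun γ _) = f h
    rw [dual_rGammaFun, InnerProductSpace.toDual_symm_apply, hL]

/-- The Cameron-Martin space `H` of `γ`, as a type carrying its own Hilbert space structure
`⟨h, k⟩_H = ⟨ĥ, k̂⟩_{L²(X, γ)}`, where `ĥ = R_γ⁻¹ h`. -/
def CameronMartin : Type u := cmSubmodule γ

namespace CameronMartin

instance : AddCommGroup (CameronMartin γ) := inferInstanceAs (AddCommGroup (cmSubmodule γ))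

instance : Module ℝ (CameronMartin γ) := inferInstanceAs (Module ℝ (cmSubmodule γ))

/-- The inclusion `H ⊆ X`. -/
def incl : CameronMartin γ →ₗ[ℝ] X := (cmSubmodule γ).subtype

/-- The linear bijection `h ↦ ĥ = R_γ⁻¹ h` from `H` onto `X_γ^*`. -/
def hatLin : CameronMartin γ ≃ₗ[ℝ] gaussHilbert γ :=
  (LinearEquiv.ofBijective (rGammaLin γ) (rGammaLin_bijective γ)).symm

instance : NormedAddCommGroup (CameronMartin γ) :=
  NormedAddCommGroup.induced (CameronMartin γ) (gaussHilbert γ) (hatLin γ).toLinearMap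
    (hatLin γ).injective

instance : InnerProductSpace ℝ (CameronMartin γ) where
  inner h k := inner ℝ (hatLin γ h) (hatLin γ k)
  norm_smul_le c h := by
    change ‖hatLin γ (c • h)‖ ≤ ‖c‖ * ‖hatLin γ h‖
    rw [map_smul, norm_smul]
  norm_sq_eq_re_inner h := by
    change ‖hatLin γ h‖ ^ 2 = _
    rw [real_inner_self_eq_norm_sq]
    rfl
  conj_inner_symm h k := by
    rw [real_inner_comm]
    rfl
  add_left h k l := by rw [map_add, inner_add_left]
  smul_left h k c := by
    rw [map_smul]
    exact inner_smul_left (hatLin γ h) (hatLin γ k) c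

/-- The unitary operator `h ↦ ĥ = R_γ⁻¹ h` from `H` onto `X_γ^*`. -/
def hat : CameronMartin γ ≃ₗᵢ[ℝ] gaussHilbert γ where
  toLinearEquiv := hatLin γ
  norm_map' _ := rfl

instance : CompleteSpace (CameronMartin γ) :=
  (hat γ).toIsometryEquiv.completeSpace

theorem dual_incl (h : CameronMartin γ) (f : StrongDual ℝ X) :
    f (incl γ h) = inner ℝ (hat γ h) (emb γ f) := by
  rw [← dual_rGammaFun]
  have h1 : rGammaLin γ (hatLin γ h) = h :=
    (LinearEquiv.ofBijective (rGammaLin γ) (rGammaLin_bijective γ)).apply_symm_apply h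
  exact congrArg f (congrArg Subtype.val h1).symm

/-- The norm of `H` is `‖h‖_H = sup {f(h) : f ∈ X*, ‖j f‖ ≤ 1}`. -/
theorem isLUB_norm (h : CameronMartin γ) : IsLUB (cmSet γ (incl γ h)) ‖h‖ := by
  constructor
  · rintro _ ⟨f, hf, rfl⟩
    rw [dual_incl]
    refine (real_inner_le_norm _ _).trans ?_
    rw [LinearIsometryEquiv.norm_map]
    exact mul_le_of_le_one_right (norm_nonneg _) hf
  · intro C hC
    have hb := abs_le_of_mem_upperBounds γ hC
    have h0 : 0 ≤ C := hC ⟨0, by simp, by simp⟩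
    have h1 : ∀ y : gaussHilbert γ, inner ℝ (hat γ h) y ≤ C * ‖y‖ := by
      intro y
      refine (denseRange_emb γ).induction_on y ?_ fun f => ?_
      · exact isClosed_le (by fun_prop) (by fun_prop)
      · rw [← dual_incl]
        exact (le_abs_self _).trans (hb f)
    have h2 := h1 (hat γ h)
    rw [real_inner_self_eq_norm_mul_norm, LinearIsometryEquiv.norm_map] at h2
    rcases eq_or_lt_of_le (norm_nonneg h) with h3 | h3
    · rw [← h3]; exact h0
    · exact le_of_mul_le_mul_right h2 h3

theorem norm_incl_le (h : CameronMartin γ) : ‖incl γ h‖ ≤ ‖centeredEmb γ‖ * ‖h‖ := by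
  refine NormedSpace.norm_le_dual_bound ℝ _ (by positivity) fun f => ?_
  rw [dual_incl]
  refine (abs_real_inner_le_norm _ _).trans ?_
  rw [LinearIsometryEquiv.norm_map, emb_norm, mul_comm, mul_right_comm]
  gcongr
  exact (centeredEmb γ).le_opNorm f

/-- The inclusion `H ⊆ X` is continuous. -/
def inclL : CameronMartin γ →L[ℝ] X :=
  (incl γ).mkContinuous ‖centeredEmb γ‖ (norm_incl_le γ)

end CameronMartin

end CameronMartin

section Sobolev

/-! ### The two gradients on smooth functions, their closures, and the Sobolev spaces -/

variable {X : Type u} [NormedAddCommGroup X] [InnerProductSpace ℝ X] [CompleteSpace X]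
  [SecondCountableTopology X] [MeasurableSpace X] [BorelSpace X] (γ : Measure X) [IsGaussian γ]

variable (X) in
/-- `C_b^1(X)`: bounded continuously differentiable functions with bounded derivative. -/
def Cb1 : Submodule ℝ (X → ℝ) where
  carrier := {f | ContDiff ℝ 1 f ∧ (∃ C, ∀ x, |f x| ≤ C) ∧ ∃ C, ∀ x, ‖fderiv ℝ f x‖ ≤ C}
  zero_mem' := ⟨contDiff_const, ⟨0, by simp⟩, ⟨0, fun x => by
    rw [show (0 : X → ℝ) = fun _ => (0 : ℝ) from rfl]; simp⟩⟩
  add_mem' := by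
    rintro f g ⟨hf, ⟨A, hA⟩, ⟨B, hB⟩⟩ ⟨hg, ⟨A', hA'⟩, ⟨B', hB'⟩⟩
    refine ⟨hf.add hg, ⟨A + A', fun x => (abs_add_le _ _).trans (add_le_add (hA x) (hA' x))⟩,
      ⟨B + B', fun x => ?_⟩⟩
    rw [fderiv_add (hf.differentiable one_ne_zero x) (hg.differentiable one_ne_zero x)]
    exact (norm_add_le _ _).trans (add_le_add (hB x) (hB' x))
  smul_mem' := by
    rintro c f ⟨hf, ⟨A, hA⟩, ⟨B, hB⟩⟩
    refine ⟨hf.const_smul c, ⟨|c| * A, fun x => ?_⟩, ⟨|c| * B, fun x => ?_⟩⟩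
    · rw [Pi.smul_apply, smul_eq_mul, abs_mul]
      gcongr
      exact hA x
    · rw [fderiv_const_smul (hf.differentiable one_ne_zero x), norm_smul, Real.norm_eq_abs]
      gcongr
      exact hB x

/-- The `H`-gradient `∇_H f(x) ∈ H`: the Riesz representative in `H` of the Fréchet derivative
at `0` of `h ↦ f (x + h)`, `h ∈ H`. -/
def gradH (f : X → ℝ) (x : X) : CameronMartin γ :=
  ∇ (fun h : CameronMartin γ => f (x + CameronMartin.incl γ h)) 0

/-- `Q^{1/2}`, with `Q` the covariance operator of the centered measure `γ`. -/
def covSqrt : X →L[ℝ] X := opSqrt (covarianceOperator γ) isPositive_covarianceOperator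

/-- The `H`-gradient as a linear map on `C_b^1(X)`. -/
def gradHLin : Cb1 X →ₗ[ℝ] (X → CameronMartin γ) where
  toFun f := gradH γ f
  map_add' f g := by
    have hd : ∀ (f : Cb1 X) (x : X), DifferentiableAt ℝ
        (fun h : CameronMartin γ => (f : X → ℝ) (x + CameronMartin.incl γ h)) 0 := fun f x =>
      ((f.2.1.differentiable one_ne_zero).comp
        ((CameronMartin.inclL γ).differentiable.const_add x)) 0
    funext x
    change (InnerProductSpace.toDual ℝ _).symm (fderiv ℝ (fun h : CameronMartin γ =>
      (f : X → ℝ) (x + CameronMartin.incl γ h) + (g : X → ℝ) (x + CameronMartin.incl γ h)) 0) = _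
    rw [fderiv_fun_add (hd f x) (hd g x), map_add]
    rfl
  map_smul' c f := by
    have hd : ∀ (f : Cb1 X) (x : X), DifferentiableAt ℝ
        (fun h : CameronMartin γ => (f : X → ℝ) (x + CameronMartin.incl γ h)) 0 := fun f x =>
      ((f.2.1.differentiable one_ne_zero).comp
        ((CameronMartin.inclL γ).differentiable.const_add x)) 0
    funext x
    change (InnerProductSpace.toDual ℝ _).symm (fderiv ℝ (fun h : CameronMartin γ =>
      c • (f : X → ℝ) (x + CameronMartin.incl γ h)) 0) = _
    rw [fderiv_fun_const_smul (hd f x), map_smulₛₗ]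
    rfl

/-- The operator `f ↦ Q^{1/2} ∇f` as a linear map on `C_b^1(X)`. -/
def sqrtGradLin : Cb1 X →ₗ[ℝ] (X → X) where
  toFun f x := covSqrt γ (∇ (f : X → ℝ) x)
  map_add' f g := by
    funext x
    change covSqrt γ ((InnerProductSpace.toDual ℝ _).symm (fderiv ℝ
      ((f : X → ℝ) + (g : X → ℝ)) x)) = _
    rw [fderiv_add (f.2.1.differentiable one_ne_zero x) (g.2.1.differentiable one_ne_zero x),
      map_add, map_add]
    rfl
  map_smul' c f := by
    funext x
    change covSqrt γ ((InnerProductSpace.toDual ℝ _).symm (fderiv ℝ (c • (f : X → ℝ)) x)) = _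
    rw [fderiv_const_smul (f.2.1.differentiable one_ne_zero x), map_smulₛₗ, map_smulₛₗ]
    rfl

/-- The graph in `L^p(X, γ) × L^p(X, γ; F)` of a linear operator `T` given on `C_b^1(X)`: all pairs
of classes `([f], [T f])` with `f ∈ C_b^1(X)`. -/
def smoothGraph {F : Type*} [NormedAddCommGroup F] [NormedSpace ℝ F] (p : ℝ≥0∞)
    (T : Cb1 X →ₗ[ℝ] (X → F)) : Submodule ℝ (Lp ℝ p γ × Lp F p γ) where
  carrier := {u | ∃ f : Cb1 X, u.1 =ᵐ[γ] (f : X → ℝ) ∧ u.2 =ᵐ[γ] T f}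
  zero_mem' := ⟨0, Lp.coeFn_zero _ _ _, by rw [map_zero]; exact Lp.coeFn_zero _ _ _⟩
  add_mem' := by
    rintro u w ⟨f, hf, hf'⟩ ⟨g, hg, hg'⟩
    refine ⟨f + g, (Lp.coeFn_add _ _).trans (hf.add hg), ?_⟩
    rw [map_add]
    exact (Lp.coeFn_add _ _).trans (hf'.add hg')
  smul_mem' := by
    rintro c u ⟨f, hf, hf'⟩
    refine ⟨c • f, (Lp.coeFn_smul _ _).trans (hf.const_smul c), ?_⟩
    rw [map_smul]
    exact (Lp.coeFn_smul _ _).trans (hf'.const_smul c)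

/-- `∇_H : C_b^1(X) → L^p(X, γ; H)` as an unbounded operator from `L^p(X, γ)`. -/
def nablaH₀ (p : ℝ≥0∞) : Lp ℝ p γ →ₗ.[ℝ] Lp (CameronMartin γ) p γ :=
  (smoothGraph γ p (gradHLin γ)).toLinearPMap

/-- `Q^{1/2}∇ : C_b^1(X) → L^p(X, γ; X)` as an unbounded operator from `L^p(X, γ)`. -/
def sqrtGrad₀ (p : ℝ≥0∞) : Lp ℝ p γ →ₗ.[ℝ] Lp X p γ :=
  (smoothGraph γ p (sqrtGradLin γ)).toLinearPMap

/-- Bogachev's Malliavin derivative: the closure of `∇_H`. -/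
def nablaH (p : ℝ≥0∞) [Fact (1 ≤ p)] : Lp ℝ p γ →ₗ.[ℝ] Lp (CameronMartin γ) p γ :=
  (nablaH₀ γ p).closure

/-- Da Prato's Malliavin derivative `M`: the closure of `Q^{1/2}∇`. -/
def daPratoM (p : ℝ≥0∞) [Fact (1 ≤ p)] : Lp ℝ p γ →ₗ.[ℝ] Lp X p γ :=
  (sqrtGrad₀ γ p).closure

/-- The Sobolev space `W^{1,p}(X, γ)`. -/
def W1p (p : ℝ≥0∞) [Fact (1 ≤ p)] : Submodule ℝ (Lp ℝ p γ) := (nablaH γ p).domain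

/-- The Sobolev space `W^{1,p}_{Q^{1/2}}(X, γ)`. -/
def W1pSqrt (p : ℝ≥0∞) [Fact (1 ≤ p)] : Submodule ℝ (Lp ℝ p γ) := (daPratoM γ p).domain

/-- The white noise map `z ↦ 𝒲_z` from `X` to `X_γ^*`: the continuous linear extension of
`Q^{1/2} y ↦ ⟨y, ·⟩`. -/
def whiteNoise : X →L[ℝ] gaussHilbert γ :=
  ((emb γ).comp (InnerProductSpace.toDualMap ℝ X).toLinearMap).extendOfNorm
    (covSqrt γ).toLinearMap

theorem norm_emb_eq (hcent : ∀ f : StrongDual ℝ X, ∫ x, f x ∂γ = 0) (y : X) :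
    ‖emb γ (InnerProductSpace.toDualMap ℝ X y)‖ = ‖covSqrt γ y‖ := by
  have h1 : ‖emb γ (InnerProductSpace.toDualMap ℝ X y)‖ ^ 2
      = inner ℝ (covarianceOperator γ y) y := by
    rw [covarianceOperator_inner IsGaussian.memLp_two_id, ← real_inner_self_eq_norm_sq,
      Submodule.coe_inner, L2.inner_def]
    refine integral_congr_ae ?_
    filter_upwards [centeredEmb_coe γ (InnerProductSpace.toDualMap ℝ X y)] with x hx
    rw [emb_coe, hx, hcent]
    simp [sq]
  have h2 : ‖covSqrt γ y‖ ^ 2 = inner ℝ (covarianceOperator γ y) y := by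
    have hS := opSqrt_isPositive (covarianceOperator γ) isPositive_covarianceOperator
    have hSS := opSqrt_comp_self (covarianceOperator γ) isPositive_covarianceOperator
    rw [← real_inner_self_eq_norm_sq]
    conv_rhs => rw [← hSS]
    exact (hS.inner_left_eq_inner_right (covSqrt γ y) y).symm
  exact (sq_eq_sq₀ (norm_nonneg _) (norm_nonneg _)).1 (h1.trans h2.symm)

theorem denseRange_covSqrt (hnd : LinearMap.ker (covarianceOperator γ).toLinearMap = ⊥) :
    DenseRange (covSqrt γ) := by
  have hS := opSqrt_isPositive (covarianceOperator γ) isPositive_covarianceOperator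
  have hSS := opSqrt_comp_self (covarianceOperator γ) isPositive_covarianceOperator
  have h : (LinearMap.range (covSqrt γ).toLinearMap)ᗮ = ⊥ := by
    rw [Submodule.eq_bot_iff]
    intro y hy
    have h1 : ∀ x, inner ℝ (covSqrt γ x) y = 0 := fun x =>
      (Submodule.mem_orthogonal _ _).1 hy _ ⟨x, rfl⟩
    have h2 : covSqrt γ y = 0 := by
      have h3 := h1 (covSqrt γ y)
      rw [covSqrt, hS.inner_left_eq_inner_right] at h3
      exact inner_self_eq_zero.1 h3
    have h4 : y ∈ LinearMap.ker (covarianceOperator γ).toLinearMap := by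
      rw [LinearMap.mem_ker]
      change covarianceOperator γ y = 0
      rw [← hSS]
      change covSqrt γ (covSqrt γ y) = 0
      rw [h2, map_zero]
    rwa [hnd] at h4
  have h5 := (Submodule.topologicalClosure_eq_top_iff).2 h
  exact Submodule.dense_iff_topologicalClosure_eq_top.2 h5

/-- For a centered nondegenerate `γ`, the white noise map is what its name says. -/
theorem whiteNoise_covSqrt (hcent : ∀ f : StrongDual ℝ X, ∫ x, f x ∂γ = 0)
    (hnd : LinearMap.ker (covarianceOperator γ).toLinearMap = ⊥) (y : X) :
    whiteNoise γ (covSqrt γ y) = emb γ (InnerProductSpace.toDualMap ℝ X y) :=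
  LinearMap.extendOfNorm_eq
    (f := (emb γ).comp (InnerProductSpace.toDualMap ℝ X).toLinearMap)
    (e := (covSqrt γ).toLinearMap) (denseRange_covSqrt γ hnd)
    ⟨1, fun x => by rw [one_mul]; exact (norm_emb_eq γ hcent x).le⟩ y

end Sobolev

section Abstract

/-! ### The abstract Malliavin derivative of a Gaussian Hilbert space `H₁ ⊆ L²(Ω, P)` associated
with a unitary operator `W : 𝓗 → H₁` -/

variable {Ω : Type u} [MeasurableSpace Ω] {P : Measure Ω} {H₁ : Submodule ℝ (Lp ℝ 2 P)}
  {𝓗 : Type v} [NormedAddCommGroup 𝓗] [InnerProductSpace ℝ 𝓗]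

/-- The random variable `q(W(h_1), …, W(h_m))`. -/
def polyVar (W : 𝓗 ≃ₗᵢ[ℝ] H₁) {m : ℕ} (q : MvPolynomial (Fin m) ℝ) (h : Fin m → 𝓗) (ω : Ω) : ℝ :=
  MvPolynomial.eval (fun i => (W (h i) : Lp ℝ 2 P) ω) q

/-- The `𝓗`-valued random variable `∑ i, ∂_i q(W(h_1), …, W(h_m)) h_i`. -/
def polyDeriv (W : 𝓗 ≃ₗᵢ[ℝ] H₁) {m : ℕ} (q : MvPolynomial (Fin m) ℝ) (h : Fin m → 𝓗) (ω : Ω) : 𝓗 :=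
  ∑ i, polyVar W (MvPolynomial.pderiv i q) h ω • h i

theorem polyVar_append (W : 𝓗 ≃ₗᵢ[ℝ] H₁) {m n : ℕ} (q : MvPolynomial (Fin m) ℝ)
    (r : MvPolynomial (Fin n) ℝ) (h : Fin m → 𝓗) (k : Fin n → 𝓗) (ω : Ω) :
    polyVar W (MvPolynomial.rename (Fin.castAdd n) q + MvPolynomial.rename (Fin.natAdd m) r)
      (Fin.append h k) ω = polyVar W q h ω + polyVar W r k ω := by
  simp [polyVar, MvPolynomial.eval_rename, Function.comp_def]

theorem polyDeriv_append (W : 𝓗 ≃ₗᵢ[ℝ] H₁) {m n : ℕ} (q : MvPolynomial (Fin m) ℝ)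
    (r : MvPolynomial (Fin n) ℝ) (h : Fin m → 𝓗) (k : Fin n → 𝓗) (ω : Ω) :
    polyDeriv W (MvPolynomial.rename (Fin.castAdd n) q + MvPolynomial.rename (Fin.natAdd m) r)
      (Fin.append h k) ω = polyDeriv W q h ω + polyDeriv W r k ω := by
  have h0 : ∀ i : Fin m, MvPolynomial.pderiv (Fin.castAdd n i)
      (MvPolynomial.rename (Fin.natAdd m) r) = 0 := fun i => by
    classical
    refine MvPolynomial.pderiv_eq_zero_of_notMem_vars fun hi => ?_
    obtain ⟨j, -, hj⟩ := Finset.mem_image.1 (MvPolynomial.vars_rename _ _ hi)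
    have := congrArg Fin.val hj
    simp at this
    omega
  have h1 : ∀ i : Fin n, MvPolynomial.pderiv (Fin.natAdd m i)
      (MvPolynomial.rename (Fin.castAdd n) q) = 0 := fun i => by
    classical
    refine MvPolynomial.pderiv_eq_zero_of_notMem_vars fun hi => ?_
    obtain ⟨j, -, hj⟩ := Finset.mem_image.1 (MvPolynomial.vars_rename _ _ hi)
    have := congrArg Fin.val hj
    simp at this
    omega
  simp only [polyDeriv]
  rw [Fin.sum_univ_add]
  congr 1
  · refine Finset.sum_congr rfl fun i _ => ?_
    rw [map_add, h0, add_zero, MvPolynomial.pderiv_rename (Fin.castAdd_injective m n)]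
    simp [polyVar, MvPolynomial.eval_rename, Function.comp_def]
  · refine Finset.sum_congr rfl fun i _ => ?_
    rw [map_add, h1, zero_add, MvPolynomial.pderiv_rename (Fin.natAdd_injective n m)]
    simp [polyVar, MvPolynomial.eval_rename, Function.comp_def]

/-- The graph in `L^p(Ω) × L^p(Ω; 𝓗)` of the operator
`q(W(h_1), …, W(h_m)) ↦ ∑ i, ∂_i q(W(h_1), …, W(h_m)) h_i` on polynomials in elements of `H₁`. -/
def polyGraph (p : ℝ≥0∞) (W : 𝓗 ≃ₗᵢ[ℝ] H₁) : Submodule ℝ (Lp ℝ p P × Lp 𝓗 p P) where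
  carrier := {u | ∃ (m : ℕ) (q : MvPolynomial (Fin m) ℝ) (h : Fin m → 𝓗),
    u.1 =ᵐ[P] polyVar W q h ∧ u.2 =ᵐ[P] polyDeriv W q h}
  zero_mem' := by
    refine ⟨0, 0, Fin.elim0, (Lp.coeFn_zero _ _ _).trans (ae_of_all _ fun ω => ?_),
      (Lp.coeFn_zero _ _ _).trans (ae_of_all _ fun ω => ?_)⟩
    · simp [polyVar]
    · simp [polyDeriv]
  add_mem' := by
    rintro u w ⟨m, q, h, hq, hq'⟩ ⟨n, r, k, hr, hr'⟩
    refine ⟨m + n, MvPolynomial.rename (Fin.castAdd n) q + MvPolynomial.rename (Fin.natAdd m) r,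
      Fin.append h k,
      ((Lp.coeFn_add _ _).trans (hq.add hr)).trans (ae_of_all _ fun ω => ?_),
      ((Lp.coeFn_add _ _).trans (hq'.add hr')).trans (ae_of_all _ fun ω => ?_)⟩
    · exact (polyVar_append W q r h k ω).symm
    · exact (polyDeriv_append W q r h k ω).symm
  smul_mem' := by
    rintro c u ⟨m, q, h, hq, hq'⟩
    refine ⟨m, c • q, h,
      ((Lp.coeFn_smul _ _).trans (hq.const_smul c)).trans (ae_of_all _ fun ω => ?_),
      ((Lp.coeFn_smul _ _).trans (hq'.const_smul c)).trans (ae_of_all _ fun ω => ?_)⟩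
    · simp [polyVar]
    · simp [polyDeriv, polyVar, Finset.smul_sum, mul_smul]

/-- `D` on polynomials in elements of `H₁`, as an unbounded operator from `L^p` to `L^p(Ω; 𝓗)`. -/
def malliavinD₀ (p : ℝ≥0∞) (W : 𝓗 ≃ₗᵢ[ℝ] H₁) : Lp ℝ p P →ₗ.[ℝ] Lp 𝓗 p P :=
  (polyGraph p W).toLinearPMap

/-- The Malliavin derivative `D` associated with `W`. -/
def malliavinD (p : ℝ≥0∞) [Fact (1 ≤ p)] (W : 𝓗 ≃ₗᵢ[ℝ] H₁) : Lp ℝ p P →ₗ.[ℝ] Lp 𝓗 p P :=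
  (malliavinD₀ p W).closure

/-- The space `𝔻^{1,p}`, the domain of `D`. -/
def D1p (p : ℝ≥0∞) [Fact (1 ≤ p)] (W : 𝓗 ≃ₗᵢ[ℝ] H₁) : Submodule ℝ (Lp ℝ p P) :=
  (malliavinD p W).domain

end Abstract

end GaussMalliavin

end

open GaussMalliavin

/-! Write `S` for `Q^{1/2}`. The white noise map is a unitary operator from `X` onto `X_γ^*`.
Composed with the inverse of `h ↦ ĥ`, it gives a unitary `V : X → H` (`cameronMartinIso`) whose
composition with the inclusion of `H` in `X` is `S`. Pairing with `V z` shows `∇_H φ(x) = V (S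
∇φ(x))` for differentiable `φ` (`gradH_eq`). Hence `V`, applied pointwise, carries the graph of `S∇`
onto that of `∇_H`. Closability, domains and norms transfer, and `∇_H F = V (M F)`, which reads `S
(M F)` in `X`.

Closability of `S∇` on every `L^p` rests on Gaussian integration by parts
(`integral_fderiv_apply_eq`), a consequence of the rotation invariance of `γ ⊗ γ`. The test
functions `cos(⟨w, x⟩ + α) / (1 + ⟨y, x⟩²)` make both sides of the formula continuous in the `L^p`
norm. A limit pair `(0, G)` then has vanishing Fourier coefficients, and `G = 0` by uniqueness of
characteristic functions (`ae_eq_zero_of_integral_cos`).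

For `p = 2`, smooth functions and polynomials are compared through a third space, the closed
subspace `weakGraph` of pairs satisfying integration by parts against trigonometric fields. A
subspace of it whose closure contains the cosines is dense in it
(`topologicalClosure_eq_weakGraph`). Indeed, if `(F, G)` is orthogonal to all cosines in the graph
inner product, then `c(t) = ∫ F cos(t⟨w, x⟩ + α) dγ` solves `c + t c' + t² σ c = 0`, whose only
solution regular at `t = 0` is zero. Cosines are smooth, and they are limits of their Taylor
polynomials, so both graphs have closure `weakGraph`. Any other `W : 𝓗 → X_γ^*` differs from white
noise by a unitary operator.

The two derivatives differ because equality on `sin⟨w, ·⟩` would force `Q w = w`. This fails for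
some `w` in infinite dimension, as `Q` has finite trace. -/

section GaussianIBP

/-! ### Gaussian integration by parts from rotation invariance. -/

open Filter Topology Real

variable {E : Type*} [NormedAddCommGroup E] [NormedSpace ℝ E] [CompleteSpace E]
  [SecondCountableTopology E] [MeasurableSpace E] [BorelSpace E]

theorem integrable_one_add_norm_pow (μ : Measure E) [IsGaussian μ] (c : ℝ) (n : ℕ) :
    Integrable (fun x => (1 + c * ‖x‖) ^ n) μ := by
  have h1 : MemLp (fun x : E => ‖x‖) (n : ℝ≥0∞) μ :=
    (IsGaussian.memLp_id μ (n : ℝ≥0∞) (ENNReal.natCast_ne_top n)).norm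
  have h2 : MemLp (fun _ : E => (1 : ℝ)) (n : ℝ≥0∞) μ := memLp_const 1
  have h : MemLp (fun x : E => 1 + c * ‖x‖) (n : ℝ≥0∞) μ := h2.add (h1.const_mul c)
  refine h.integrable_norm_pow'.mono' (by fun_prop) (ae_of_all _ fun x => ?_)
  rw [norm_pow]

theorem norm_cos_smul_add_sin_smul_le (θ : ℝ) (p : E × E) :
    ‖cos θ • p.1 + sin θ • p.2‖ ≤ 2 * ‖p‖ := by
  refine (norm_add_le _ _).trans ?_
  rw [norm_smul, norm_smul, two_mul]
  exact add_le_add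
    ((mul_le_of_le_one_left (norm_nonneg _) (abs_cos_le_one θ)).trans (norm_fst_le p))
    ((mul_le_of_le_one_left (norm_nonneg _) (abs_sin_le_one θ)).trans (norm_snd_le p))

theorem norm_neg_sin_smul_add_cos_smul_le (θ : ℝ) (p : E × E) :
    ‖-sin θ • p.1 + cos θ • p.2‖ ≤ 2 * ‖p‖ := by
  have := norm_cos_smul_add_sin_smul_le (θ + π / 2) p
  rwa [cos_add_pi_div_two, sin_add_pi_div_two] at this

/-- Gaussian integration by parts, obtained by differentiating along the rotations of `E × E`. -/
theorem integral_fderiv_apply_eq (μ : Measure E) [IsGaussian μ]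
    (hμ : ∀ l : StrongDual ℝ E, ∫ x, l x ∂μ = 0) {f : E → ℝ} (hf : ContDiff ℝ 1 f) {C : ℝ} {k : ℕ}
    (h0 : ∀ x, |f x| ≤ C * (1 + ‖x‖) ^ k) (h1 : ∀ x, ‖fderiv ℝ f x‖ ≤ C * (1 + ‖x‖) ^ k)
    (l : StrongDual ℝ E) :
    ∫ x, fderiv ℝ f x (∫ y, l y • y ∂μ) ∂μ = ∫ x, f x * l x ∂μ := by
  have hC : 0 ≤ C := by
    have := (abs_nonneg _).trans (h0 0)
    simpa using this
  -- The pair `(a, b)` is the rotation of `(x, y)` by the angle `θ`; its derivative in `θ` is `(b,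
  -- -a)`.
  let a : ℝ → E × E → E := fun θ p => cos θ • p.1 + sin θ • p.2
  let b : ℝ → E × E → E := fun θ p => -sin θ • p.1 + cos θ • p.2
  let F : ℝ → E × E → ℝ := fun θ p => f (a θ p) * l (b θ p)
  let F' : ℝ → E × E → ℝ := fun θ p =>
    fderiv ℝ f (a θ p) (b θ p) * l (b θ p) + f (a θ p) * l (-a θ p)
  -- A bound for `F` and `F'` alike: `k` powers come from `f` or its derivative, two more absorb the
  -- at most two linear factors.
  let B : E × E → ℝ := fun p => 2 * (C * ‖l‖) * (1 + 2 * ‖p‖) ^ (k + 2)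
  have hfd : Differentiable ℝ f := hf.differentiable one_ne_zero
  have hf' : Continuous (fderiv ℝ f) := hf.continuous_fderiv one_ne_zero
  have hfc : Continuous f := hf.continuous
  have ha : ∀ θ, Continuous (a θ) := fun θ => by fun_prop
  have hb : ∀ θ, Continuous (b θ) := fun θ => by fun_prop
  have hFc : ∀ θ, Continuous (F θ) := fun θ => by fun_prop
  have hFc' : ∀ θ, Continuous (F' θ) := fun θ => by
    have : Continuous fun p => fderiv ℝ f (a θ p) (b θ p) :=
      (hf'.comp (ha θ)).clm_apply (hb θ)
    fun_prop
  have hda : ∀ p θ, HasDerivAt (fun θ => a θ p) (b θ p) θ := fun p θ => by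
    have := ((hasDerivAt_cos θ).smul_const p.1).add ((hasDerivAt_sin θ).smul_const p.2)
    exact this
  have hdb : ∀ p θ, HasDerivAt (fun θ => b θ p) (-a θ p) θ := fun p θ => by
    have := ((hasDerivAt_sin θ).neg.smul_const p.1).add ((hasDerivAt_cos θ).smul_const p.2)
    convert! this using 1
    simp only [a, neg_smul, neg_add]
  have hdF : ∀ p θ, HasDerivAt (fun θ => F θ p) (F' θ p) θ := fun p θ =>
    ((hfd _).hasFDerivAt.comp_hasDerivAt θ (hda p θ)).mul
      (l.hasFDerivAt.comp_hasDerivAt θ (hdb p θ))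
  have hna : ∀ θ p, ‖a θ p‖ ≤ 2 * ‖p‖ := norm_cos_smul_add_sin_smul_le
  have hnb : ∀ θ p, ‖b θ p‖ ≤ 2 * ‖p‖ := norm_neg_sin_smul_add_cos_smul_le
  have hbF : ∀ θ p, |F θ p| ≤ B p := fun θ p => by
    have e1 : |l (b θ p)| ≤ ‖l‖ * (2 * ‖p‖) := (l.le_opNorm _).trans (by gcongr; exact hnb θ p)
    have e2 : |f (a θ p)| ≤ C * (1 + 2 * ‖p‖) ^ k := (h0 _).trans (by gcongr; exact hna θ p)
    calc |F θ p| = |f (a θ p)| * |l (b θ p)| := abs_mul _ _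
      _ ≤ (C * (1 + 2 * ‖p‖) ^ k) * (‖l‖ * (2 * ‖p‖)) := by gcongr
      _ = (C * ‖l‖) * (1 + 2 * ‖p‖) ^ k * (2 * ‖p‖) := by ring
      _ ≤ (C * ‖l‖) * (1 + 2 * ‖p‖) ^ k * (2 * (1 + 2 * ‖p‖) ^ 2) := by
        gcongr
        nlinarith [norm_nonneg p]
      _ = B p := by simp only [B]; ring
  have hbF' : ∀ θ p, ‖F' θ p‖ ≤ B p := fun θ p => by
    have e1 : |l (b θ p)| ≤ ‖l‖ * (2 * ‖p‖) := (l.le_opNorm _).trans (by gcongr; exact hnb θ p)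
    have e1' : |l (-a θ p)| ≤ ‖l‖ * (2 * ‖p‖) :=
      (l.le_opNorm _).trans (by gcongr; rw [norm_neg]; exact hna θ p)
    have e2 : |f (a θ p)| ≤ C * (1 + 2 * ‖p‖) ^ k := (h0 _).trans (by gcongr; exact hna θ p)
    have e3 : |fderiv ℝ f (a θ p) (b θ p)| ≤ C * (1 + 2 * ‖p‖) ^ k * (2 * ‖p‖) := by
      refine ((fderiv ℝ f (a θ p)).le_opNorm _).trans ?_
      refine mul_le_mul ((h1 _).trans ?_) (hnb θ p) (norm_nonneg _) (by positivity)
      gcongr; exact hna θ p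
    calc ‖F' θ p‖ ≤ |fderiv ℝ f (a θ p) (b θ p) * l (b θ p)| + |f (a θ p) * l (-a θ p)| :=
          norm_add_le _ _
      _ ≤ C * (1 + 2 * ‖p‖) ^ k * (2 * ‖p‖) * (‖l‖ * (2 * ‖p‖))
          + C * (1 + 2 * ‖p‖) ^ k * (‖l‖ * (2 * ‖p‖)) := by
        rw [abs_mul, abs_mul]; gcongr
      _ = (C * ‖l‖) * (1 + 2 * ‖p‖) ^ k * ((2 * ‖p‖) ^ 2 + 2 * ‖p‖) := by ring
      _ ≤ (C * ‖l‖) * (1 + 2 * ‖p‖) ^ k * (2 * (1 + 2 * ‖p‖) ^ 2) := by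
        gcongr
        nlinarith [norm_nonneg p]
      _ = B p := by simp only [B]; ring
  have hB : Integrable B (μ.prod μ) := (integrable_one_add_norm_pow _ 2 _).const_mul _
  have hFi : ∀ θ, Integrable (F θ) (μ.prod μ) := fun θ =>
    hB.mono' (hFc θ).aestronglyMeasurable (ae_of_all _ (hbF θ))
  have hderiv := (hasDerivAt_integral_of_dominated_loc_of_deriv_le (μ := μ.prod μ) (F := F)
    (F' := F') (x₀ := 0) (bound := B) univ_mem
    (Eventually.of_forall fun θ => (hFc θ).aestronglyMeasurable) (hFi 0)
    (hFc' 0).aestronglyMeasurable (ae_of_all _ fun p θ _ => hbF' θ p) hB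
    (ae_of_all _ fun p θ _ => hdF p θ)).2
  -- The product of a centered Gaussian measure with itself is invariant under rotations.
  have hconst : ∀ θ, ∫ p, F θ p ∂(μ.prod μ) = ∫ p : E × E, f p.1 * l p.2 ∂(μ.prod μ) := fun θ => by
    have hm := IsGaussian.map_rotation_eq_self_of_forall_strongDual_eq_zero hμ θ
    conv_rhs => rw [← hm]
    rw [integral_map (by fun_prop) (by fun_prop)]
    rfl
  have hzero : ∫ p, F' 0 p ∂(μ.prod μ) = 0 := by
    simp_rw [hconst] at hderiv
    exact hderiv.unique (hasDerivAt_const _ _)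
  -- At `θ = 0` the vanishing derivative is already the claim, once `y` is integrated out of the
  -- first term to produce the direction `∫ l(y) y dμ`.
  have e0 : ∀ p, F' 0 p = fderiv ℝ f p.1 p.2 * l p.2 - f p.1 * l p.1 := fun p => by
    simp [F', a, b, sub_eq_add_neg]
  have hi2 : Integrable (fun p : E × E => f p.1 * l p.1) (μ.prod μ) := by
    refine hB.mono' (by fun_prop) (ae_of_all _ fun p => ?_)
    have e1 : |l p.1| ≤ ‖l‖ * ‖p‖ := (l.le_opNorm _).trans (by gcongr; exact norm_fst_le p)
    have e2 : |f p.1| ≤ C * (1 + 2 * ‖p‖) ^ k := (h0 _).trans (by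
      gcongr; linarith [norm_fst_le p, norm_nonneg p])
    calc |f p.1 * l p.1| = |f p.1| * |l p.1| := abs_mul _ _
      _ ≤ (C * (1 + 2 * ‖p‖) ^ k) * (‖l‖ * ‖p‖) := by gcongr
      _ = (C * ‖l‖) * (1 + 2 * ‖p‖) ^ k * ‖p‖ := by ring
      _ ≤ (C * ‖l‖) * (1 + 2 * ‖p‖) ^ k * (2 * (1 + 2 * ‖p‖) ^ 2) := by
        gcongr
        nlinarith [norm_nonneg p]
      _ = B p := by simp only [B]; ring
  have hF'i : Integrable (F' 0) (μ.prod μ) :=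
    hB.mono' (hFc' 0).aestronglyMeasurable (ae_of_all _ (hbF' 0))
  have hi1 : Integrable (fun p : E × E => fderiv ℝ f p.1 p.2 * l p.2) (μ.prod μ) :=
    (hF'i.add hi2).congr (ae_of_all _ fun p => by rw [Pi.add_apply, e0]; ring)
  simp_rw [e0] at hzero
  rw [integral_sub hi1 hi2, sub_eq_zero, integral_prod _ hi1] at hzero
  have e3 : ∫ p : E × E, f p.1 * l p.1 ∂(μ.prod μ) = ∫ x, f x * l x ∂μ := by
    rw [integral_fun_fst (fun x => f x * l x)]
    simp
  rw [e3] at hzero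
  rw [← hzero]
  refine integral_congr_ae (ae_of_all _ fun x => ?_)
  have hli : Integrable (fun y => l y • y) μ :=
    memLp_one_iff_integrable.1
      ((IsGaussian.memLp_two_id (μ := μ)).smul (IsGaussian.memLp_dual μ l 2 (by simp)))
  change fderiv ℝ f x (∫ y, l y • y ∂μ) = ∫ y, fderiv ℝ f x y * l y ∂μ
  rw [← ContinuousLinearMap.integral_comp_comm _ hli]
  refine integral_congr_ae (ae_of_all _ fun y => ?_)
  simp [mul_comm]

end GaussianIBP

/-! ### Elements of the Gaussian Hilbert space as jointly Gaussian variables. -/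

section GaussianVector

open Filter Topology

variable {X : Type u} [NormedAddCommGroup X] [NormedSpace ℝ X] [CompleteSpace X]
  [SecondCountableTopology X] [MeasurableSpace X] [BorelSpace X] {γ : Measure X} [IsGaussian γ]

theorem norm_cexp_mul_I_sub_le (a b : ℝ) :
    ‖Complex.exp (a * Complex.I) - Complex.exp (b * Complex.I)‖ ≤ |a - b| := by
  have h : Complex.exp (a * Complex.I) - Complex.exp (b * Complex.I)
      = Complex.exp (b * Complex.I) * (Complex.exp (Complex.I * ((a - b : ℝ) : ℂ)) - 1) := by
    rw [mul_sub, ← Complex.exp_add, mul_one]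
    congr 2
    push_cast
    ring
  rw [h, norm_mul, Complex.norm_exp_ofReal_mul_I, one_mul]
  exact Real.norm_exp_I_mul_ofReal_sub_one_le

theorem integral_norm_le_norm_Lp {Ω : Type*} [MeasurableSpace Ω] {P : Measure Ω}
    [IsProbabilityMeasure P] {E : Type*} [NormedAddCommGroup E] {p : ℝ≥0∞} (hp : 1 ≤ p)
    (F : Lp E p P) : ∫ x, ‖F x‖ ∂P ≤ ‖F‖ := by
  rw [integral_norm_eq_lintegral_enorm (Lp.aestronglyMeasurable F), Lp.norm_def,
    ← eLpNorm_one_eq_lintegral_enorm]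
  exact ENNReal.toReal_mono (Lp.eLpNorm_ne_top F)
    (eLpNorm_le_eLpNorm_of_exponent_le hp (Lp.aestronglyMeasurable F))

theorem integrable_cexp_mul_I {Ω : Type*} [MeasurableSpace Ω] {P : Measure Ω}
    [IsFiniteMeasure P] {F : Ω → ℝ} (hF : AEStronglyMeasurable F P) :
    Integrable (fun x => Complex.exp (F x * Complex.I)) P := by
  refine (integrable_const (1 : ℝ)).mono' ?_ (ae_of_all _ fun x => ?_)
  · exact (Complex.continuous_exp.comp
      (Complex.continuous_ofReal.mul continuous_const)).comp_aestronglyMeasurable hF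
  · rw [Complex.norm_exp_ofReal_mul_I]

/-- The map is 1-Lipschitz, as `|e^{ia} - e^{ib}| ≤ |a - b|` and the `L¹` norm is at most the `L²`
norm. It lets characteristic functions pass from `j(X*)` to its closure. -/
theorem continuous_integral_cexp {Ω : Type*} [MeasurableSpace Ω] (P : Measure Ω)
    [IsProbabilityMeasure P] :
    Continuous fun F : Lp ℝ 2 P => ∫ x, Complex.exp (F x * Complex.I) ∂P := by
  have h : LipschitzWith 1 fun F : Lp ℝ 2 P => ∫ x, Complex.exp (F x * Complex.I) ∂P := by
    refine LipschitzWith.of_dist_le_mul fun F G => ?_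
    rw [NNReal.coe_one, one_mul, dist_eq_norm, dist_eq_norm,
      ← integral_sub (integrable_cexp_mul_I (Lp.aestronglyMeasurable F))
        (integrable_cexp_mul_I (Lp.aestronglyMeasurable G))]
    refine (norm_integral_le_integral_norm _).trans
      (le_trans ?_ (integral_norm_le_norm_Lp one_le_two (F - G)))
    refine integral_mono_ae ?_ ((Lp.memLp (F - G)).integrable one_le_two).norm ?_
    · exact ((integrable_cexp_mul_I (Lp.aestronglyMeasurable F)).sub
        (integrable_cexp_mul_I (Lp.aestronglyMeasurable G))).norm
    · filter_upwards [Lp.coeFn_sub F G] with x hx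
      rw [hx]
      exact norm_cexp_mul_I_sub_le _ _
  exact h.continuous

theorem variance_dual_eq_norm_emb (f : StrongDual ℝ X) : Var[f; γ] = ‖emb γ f‖ ^ 2 := by
  rw [variance_eq_integral (by fun_prop), ← real_inner_self_eq_norm_sq, Submodule.coe_inner,
    L2.inner_def]
  refine integral_congr_ae ?_
  filter_upwards [centeredEmb_coe γ f] with x hx
  rw [emb_coe, hx]
  simp [sq]

theorem integral_cexp_gaussHilbert (g : gaussHilbert γ) :
    ∫ x, Complex.exp ((g : Lp ℝ 2 γ) x * Complex.I) ∂γ = Complex.exp (-(‖g‖ ^ 2 : ℝ) / 2) := by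
  refine (denseRange_emb γ).induction_on (p := fun g : gaussHilbert γ =>
    ∫ x, Complex.exp ((g : Lp ℝ 2 γ) x * Complex.I) ∂γ = Complex.exp (-(‖g‖ ^ 2 : ℝ) / 2)) g ?_ ?_
  · exact isClosed_eq ((continuous_integral_cexp γ).comp continuous_subtype_val) (by fun_prop)
  · intro f
    have h := IsGaussian.charFunDual_eq (μ := γ) f
    rw [variance_dual_eq_norm_emb, charFunDual_apply, integral_complex_ofReal] at h
    have h1 : ∫ x, Complex.exp ((emb γ f : Lp ℝ 2 γ) x * Complex.I) ∂γ
        = ∫ x, Complex.exp (f x * Complex.I) * Complex.exp (-((∫ y, f y ∂γ : ℝ) * Complex.I)) ∂γ := by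
      refine integral_congr_ae ?_
      filter_upwards [centeredEmb_coe γ f] with x hx
      rw [emb_coe, hx, ← Complex.exp_add]
      congr 1
      push_cast
      ring
    rw [h1, integral_mul_const, h, ← Complex.exp_add]
    congr 1
    ring

/-- Every element of the Gaussian Hilbert space is a centered Gaussian random variable. -/
theorem map_gaussHilbert (g : gaussHilbert γ) :
    γ.map (g : Lp ℝ 2 γ) = gaussianReal 0 (‖g‖ ^ 2).toNNReal := by
  have hm : AEMeasurable (g : Lp ℝ 2 γ) γ := (Lp.aestronglyMeasurable _).aemeasurable
  have := Measure.isProbabilityMeasure_map hm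
  refine Measure.ext_of_charFun (funext fun t => ?_)
  rw [charFun_apply_real, charFun_gaussianReal, integral_map hm (by fun_prop)]
  -- Scaling `g` by `t` turns the formula at frequency one into the whole characteristic function.
  have h := integral_cexp_gaussHilbert (t • g)
  have h1 : ∫ x, Complex.exp (((t • g : gaussHilbert γ) : Lp ℝ 2 γ) x * Complex.I) ∂γ
      = ∫ x, Complex.exp (t * (g : Lp ℝ 2 γ) x * Complex.I) ∂γ := by
    refine integral_congr_ae ?_
    filter_upwards [Lp.coeFn_smul t (g : Lp ℝ 2 γ)] with x hx
    rw [Submodule.coe_smul, hx]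
    simp
  rw [← h1, h, norm_smul]
  congr 1
  rw [Real.coe_toNNReal _ (by positivity)]
  simp [mul_pow]
  ring

variable {ι : Type*} [Fintype ι]

/-- The random vector of finitely many elements of the Gaussian Hilbert space. -/
noncomputable def gaussVec (g : ι → gaussHilbert γ) (x : X) (i : ι) : ℝ := (g i : Lp ℝ 2 γ) x

theorem measurable_gaussVec (g : ι → gaussHilbert γ) : Measurable (gaussVec g) :=
  measurable_pi_lambda _ fun i => (Lp.stronglyMeasurable (g i : Lp ℝ 2 γ)).measurable

/-- A linear functional of the vector is again an element of the Gaussian Hilbert space, hence a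
one-dimensional Gaussian; this is joint Gaussianity. -/
theorem dual_gaussVec [DecidableEq ι] (g : ι → gaussHilbert γ) (L : StrongDual ℝ (ι → ℝ)) :
    (fun x => L (gaussVec g x)) =ᵐ[γ]
      ((∑ i, L (Pi.single i 1) • g i : gaussHilbert γ) : Lp ℝ 2 γ) := by
  have h1 : ((∑ i, L (Pi.single i 1) • g i : gaussHilbert γ) : Lp ℝ 2 γ)
      = ∑ i, L (Pi.single i 1) • (g i : Lp ℝ 2 γ) := by simp
  rw [h1]
  have h2 : ∀ᵐ x ∂γ, ∀ i, (L (Pi.single i 1) • (g i : Lp ℝ 2 γ) : Lp ℝ 2 γ) x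
      = L (Pi.single i 1) * (g i : Lp ℝ 2 γ) x := by
    rw [ae_all_iff]
    exact fun i => Lp.coeFn_smul _ _
  filter_upwards [h2, Lp.coeFn_finsetSum Finset.univ
    fun i => L (Pi.single i 1) • (g i : Lp ℝ 2 γ)] with x hx hs
  rw [hs, Finset.sum_apply]
  simp_rw [hx]
  conv_lhs => rw [pi_eq_sum_univ' (gaussVec g x)]
  rw [map_sum]
  refine Finset.sum_congr rfl fun i _ => ?_
  rw [map_smul, smul_eq_mul, mul_comm]
  rfl

instance isGaussian_map_gaussVec (g : ι → gaussHilbert γ) : IsGaussian (γ.map (gaussVec g)) := by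
  classical
  refine isGaussian_of_map_eq_gaussianReal fun L =>
    ⟨0, (‖∑ i, L (Pi.single i 1) • g i‖ ^ 2).toNNReal, ?_⟩
  rw [Measure.map_map (by fun_prop) (measurable_gaussVec g), ← map_gaussHilbert]
  exact Measure.map_congr (dual_gaussVec g L)

theorem integral_gaussHilbert (g : gaussHilbert γ) : ∫ x, (g : Lp ℝ 2 γ) x ∂γ = 0 := by
  have hm : AEMeasurable (g : Lp ℝ 2 γ) γ := (Lp.aestronglyMeasurable _).aemeasurable
  have h : ∫ y, y ∂(γ.map (g : Lp ℝ 2 γ)) = ∫ x, (g : Lp ℝ 2 γ) x ∂γ :=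
    integral_map hm (by fun_prop)
  rw [← h, map_gaussHilbert, integral_id_gaussianReal]

theorem integral_dual_map_gaussVec (g : ι → gaussHilbert γ) (L : StrongDual ℝ (ι → ℝ)) :
    ∫ u, L u ∂(γ.map (gaussVec g)) = 0 := by
  classical
  rw [integral_map (measurable_gaussVec g).aemeasurable (by fun_prop),
    integral_congr_ae (dual_gaussVec g L), integral_gaussHilbert]

/-- The law of the vector is Gaussian, so its norm has moments of all orders. -/
theorem memLp_comp_gaussVec (g : ι → gaussHilbert γ) {F : Type*} [NormedAddCommGroup F]
    {f : (ι → ℝ) → F} (hf : Continuous f) {C : ℝ} {k : ℕ}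
    (h0 : ∀ u, ‖f u‖ ≤ C * (1 + ‖u‖) ^ k) : MemLp (fun x => f (gaussVec g x)) 2 γ := by
  have h1 : MemLp (fun u : ι → ℝ => C * (1 + ‖u‖) ^ k) 2 (γ.map (gaussVec g)) := by
    refine MemLp.const_mul ?_ C
    rw [memLp_two_iff_integrable_sq (by fun_prop)]
    have := integrable_one_add_norm_pow (γ.map (gaussVec g)) 1 (k * 2)
    simpa [pow_mul] using this
  have h2 : MemLp f 2 (γ.map (gaussVec g)) :=
    h1.mono' hf.aestronglyMeasurable (ae_of_all _ h0)
  exact (memLp_map_measure_iff hf.aestronglyMeasurable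
    (measurable_gaussVec g).aemeasurable).1 h2

/-- Integration by parts for a smooth function of finitely many elements of the Gaussian Hilbert
space. -/
theorem integral_fderiv_gaussVec (g : ι → gaussHilbert γ) {f : (ι → ℝ) → ℝ}
    (hf : ContDiff ℝ 1 f) {C : ℝ} {k : ℕ} (h0 : ∀ x, |f x| ≤ C * (1 + ‖x‖) ^ k)
    (h1 : ∀ x, ‖fderiv ℝ f x‖ ≤ C * (1 + ‖x‖) ^ k) (j : ι) :
    ∫ x, fderiv ℝ f (gaussVec g x) (fun i => inner ℝ (g i) (g j)) ∂γ
      = ∫ x, f (gaussVec g x) * (g j : Lp ℝ 2 γ) x ∂γ := by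
  have hY := measurable_gaussVec g
  have h := integral_fderiv_apply_eq (γ.map (gaussVec g)) (integral_dual_map_gaussVec g) hf h0 h1
    (ContinuousLinearMap.proj j)
  have hint : Integrable (fun u : ι → ℝ => (ContinuousLinearMap.proj (R := ℝ) j :
      StrongDual ℝ (ι → ℝ)) u • u) (γ.map (gaussVec g)) :=
    memLp_one_iff_integrable.1 ((IsGaussian.memLp_two_id (μ := γ.map (gaussVec g))).smul
      (IsGaussian.memLp_dual (γ.map (gaussVec g)) _ 2 (by simp)))
  -- The direction of differentiation is column `j` of the Gram matrix, which may be singular.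
  have hv : ∫ u, (ContinuousLinearMap.proj (R := ℝ) j : StrongDual ℝ (ι → ℝ)) u • u
      ∂(γ.map (gaussVec g)) = fun i => inner ℝ (g i) (g j) := by
    funext i
    rw [← ContinuousLinearMap.proj_apply (R := ℝ) (φ := fun _ : ι => ℝ) i
      (∫ u, _ ∂(γ.map (gaussVec g))), ← ContinuousLinearMap.integral_comp_comm _ hint,
      integral_map hY.aemeasurable (by fun_prop), Submodule.coe_inner, L2.inner_def]
    refine integral_congr_ae (ae_of_all _ fun x => ?_)
    simp [gaussVec]
  have hfc := hf.continuous
  rw [hv, integral_map hY.aemeasurable (by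
      exact ((hf.continuous_fderiv one_ne_zero).clm_apply continuous_const).aestronglyMeasurable),
    integral_map hY.aemeasurable (by fun_prop)] at h
  exact h

end GaussianVector

/-! ### Functions of polynomial growth. -/

section PolynomialGrowth

variable {E F : Type*} [NormedAddCommGroup E] [NormedAddCommGroup F]

/-- Functions of at most polynomial growth. -/
def PolyGrowth (f : E → F) : Prop := ∃ (C : ℝ) (k : ℕ), 0 ≤ C ∧ ∀ x, ‖f x‖ ≤ C * (1 + ‖x‖) ^ k

theorem PolyGrowth.of_bounded {f : E → F} {C : ℝ} (h : ∀ x, ‖f x‖ ≤ C) : PolyGrowth f :=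
  ⟨C, 0, (norm_nonneg _).trans (h 0), fun x => by simpa using h x⟩

theorem PolyGrowth.add {f g : E → F} (hf : PolyGrowth f) (hg : PolyGrowth g) :
    PolyGrowth fun x => f x + g x := by
  obtain ⟨C, k, hC, h⟩ := hf
  obtain ⟨D, l, hD, h'⟩ := hg
  refine ⟨C + D, k + l, by positivity, fun x => ?_⟩
  have h1 : 1 ≤ 1 + ‖x‖ := by linarith [norm_nonneg x]
  calc ‖f x + g x‖ ≤ C * (1 + ‖x‖) ^ k + D * (1 + ‖x‖) ^ l :=
        (norm_add_le _ _).trans (add_le_add (h x) (h' x))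
    _ ≤ C * (1 + ‖x‖) ^ (k + l) + D * (1 + ‖x‖) ^ (k + l) := by
      gcongr <;> first | exact h1 | omega
    _ = _ := by ring

theorem PolyGrowth.smul [NormedSpace ℝ F] {f : E → ℝ} {g : E → F} (hf : PolyGrowth f)
    (hg : PolyGrowth g) : PolyGrowth fun x => f x • g x := by
  obtain ⟨C, k, hC, h⟩ := hf
  obtain ⟨D, l, hD, h'⟩ := hg
  refine ⟨C * D, k + l, by positivity, fun x => ?_⟩
  calc ‖f x • g x‖ = ‖f x‖ * ‖g x‖ := norm_smul _ _
    _ ≤ (C * (1 + ‖x‖) ^ k) * (D * (1 + ‖x‖) ^ l) := by gcongr <;> [exact h x; exact h' x]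
    _ = _ := by ring

theorem PolyGrowth.sum {ι : Type*} (s : Finset ι) {f : ι → E → F}
    (h : ∀ i, PolyGrowth (f i)) : PolyGrowth fun x => ∑ i ∈ s, f i x := by
  classical
  induction s using Finset.induction_on with
  | empty => simpa using PolyGrowth.of_bounded (f := fun _ : E => (0 : F)) (C := 0) (by simp)
  | insert a s ha ih =>
    simp_rw [Finset.sum_insert ha]
    exact (h a).add ih

/-- Common constants for two functions of polynomial growth. -/
theorem PolyGrowth.exists_common {G : Type*} [NormedAddCommGroup G] {f : E → F} {g : E → G}
    (hf : PolyGrowth f) (hg : PolyGrowth g) : ∃ (C : ℝ) (k : ℕ),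
      (∀ x, ‖f x‖ ≤ C * (1 + ‖x‖) ^ k) ∧ ∀ x, ‖g x‖ ≤ C * (1 + ‖x‖) ^ k := by
  obtain ⟨C, k, hC, h⟩ := hf
  obtain ⟨D, l, hD, h'⟩ := hg
  refine ⟨C + D, k + l, fun x => (h x).trans ?_, fun x => (h' x).trans ?_⟩
  all_goals
    have h1 : 1 ≤ 1 + ‖x‖ := by linarith [norm_nonneg x]
    gcongr <;> first | exact h1 | omega | linarith

end PolynomialGrowth

/-! ### Polynomials in Gaussian variables. -/

section PolynomialCalculus

variable {ι : Type*} [Fintype ι]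

theorem polyGrowth_eval (q : MvPolynomial ι ℝ) :
    PolyGrowth fun u : ι → ℝ => MvPolynomial.eval u q := by
  induction q using MvPolynomial.induction_on with
  | C a => exact PolyGrowth.of_bounded (C := ‖a‖) (by simp)
  | add p q hp hq => simpa using hp.add hq
  | mul_X p i hp =>
    have h : PolyGrowth fun u : ι → ℝ => u i :=
      ⟨1, 1, zero_le_one, fun u => by linarith [norm_le_pi_norm u i]⟩
    simpa using hp.smul h

/-- The derivative of a polynomial function of finitely many variables. -/
noncomputable def evalDeriv (q : MvPolynomial ι ℝ) (u : ι → ℝ) : (ι → ℝ) →L[ℝ] ℝ :=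
  ∑ i, MvPolynomial.eval u (MvPolynomial.pderiv i q) • ContinuousLinearMap.proj i

theorem evalDeriv_apply (q : MvPolynomial ι ℝ) (u v : ι → ℝ) :
    evalDeriv q u v = ∑ i, MvPolynomial.eval u (MvPolynomial.pderiv i q) * v i := by
  simp [evalDeriv]

theorem hasFDerivAt_eval (q : MvPolynomial ι ℝ) (u : ι → ℝ) :
    HasFDerivAt (fun u : ι → ℝ => MvPolynomial.eval u q) (evalDeriv q u) u := by
  classical
  induction q using MvPolynomial.induction_on with
  | C a =>
    have h : evalDeriv (MvPolynomial.C a) u = 0 := by simp [evalDeriv]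
    rw [h]
    simpa using hasFDerivAt_const a u
  | add p q hp hq =>
    have h : evalDeriv (p + q) u = evalDeriv p u + evalDeriv q u := by
      simp [evalDeriv, add_smul, Finset.sum_add_distrib]
    rw [h]
    simpa only [map_add] using hp.fun_add hq
  | mul_X p i hp =>
    have h : evalDeriv (p * MvPolynomial.X i) u = MvPolynomial.eval u p •
        (ContinuousLinearMap.proj i : (ι → ℝ) →L[ℝ] ℝ) + u i • evalDeriv p u := by
      ext v
      simp only [evalDeriv_apply, add_apply, smul_apply, Derivation.leibniz, map_add, smul_eq_mul,
        map_mul, MvPolynomial.eval_X, MvPolynomial.pderiv_X, add_mul, Finset.sum_add_distrib,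
        Finset.mul_sum, ContinuousLinearMap.proj_apply]
      congr 1
      · rw [Finset.sum_eq_single i]
        · simp
        · intro j _ hj
          simp [hj.symm]
        · simp
      · exact Finset.sum_congr rfl fun j _ => by ring
    rw [h]
    have h2 : HasFDerivAt (fun u : ι → ℝ => u i) (ContinuousLinearMap.proj i) u :=
      (ContinuousLinearMap.proj (R := ℝ) (φ := fun _ : ι => ℝ) i).hasFDerivAt
    simpa only [map_mul, MvPolynomial.eval_X] using hp.fun_mul h2

theorem continuous_eval (q : MvPolynomial ι ℝ) :
    Continuous fun u : ι → ℝ => MvPolynomial.eval u q :=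
  MvPolynomial.continuous_eval q

theorem continuous_evalDeriv (q : MvPolynomial ι ℝ) : Continuous (evalDeriv q) :=
  continuous_finsetSum _ fun _ _ => (continuous_eval _).smul continuous_const

theorem polyGrowth_evalDeriv (q : MvPolynomial ι ℝ) : PolyGrowth (evalDeriv q) :=
  PolyGrowth.sum _ fun i => (polyGrowth_eval _).smul
    (PolyGrowth.of_bounded (C := ‖(ContinuousLinearMap.proj i : (ι → ℝ) →L[ℝ] ℝ)‖)
      fun _ => le_rfl)

variable {X : Type u} [NormedAddCommGroup X] [NormedSpace ℝ X] [CompleteSpace X]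
  [SecondCountableTopology X] [MeasurableSpace X] [BorelSpace X] {γ : Measure X} [IsGaussian γ]

/-- Integration by parts for `u ↦ q(u) cos(u_b + α)`: coordinate `b` carries the trigonometric test
function, coordinate `j` the direction. -/
theorem integral_poly_cos_gaussVec (g : ι → gaussHilbert γ) (q : MvPolynomial ι ℝ) (b j : ι)
    (α : ℝ) :
    ∫ x, ((∑ i, MvPolynomial.eval (gaussVec g x) (MvPolynomial.pderiv i q) *
          inner ℝ (g i) (g j)) * Real.cos (gaussVec g x b + α)
        - MvPolynomial.eval (gaussVec g x) q *
          (Real.sin (gaussVec g x b + α) * inner ℝ (g b) (g j))) ∂γ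
      = ∫ x, MvPolynomial.eval (gaussVec g x) q * Real.cos (gaussVec g x b + α) *
          gaussVec g x j ∂γ := by
  set f : (ι → ℝ) → ℝ := fun u => MvPolynomial.eval u q * Real.cos (u b + α) with hf
  set f' : (ι → ℝ) → ((ι → ℝ) →L[ℝ] ℝ) := fun u =>
    MvPolynomial.eval u q • (-Real.sin (u b + α) • ContinuousLinearMap.proj b)
      + Real.cos (u b + α) • evalDeriv q u with hf'
  have hd : ∀ u, HasFDerivAt f (f' u) u := fun u => by
    have h2 : HasFDerivAt (fun u : ι → ℝ => u b + α) (ContinuousLinearMap.proj b) u :=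
      (ContinuousLinearMap.proj (R := ℝ) (φ := fun _ : ι => ℝ) b).hasFDerivAt.add_const α
    exact (hasFDerivAt_eval q u).mul h2.cos
  have hfd : fderiv ℝ f = f' := funext fun u => (hd u).fderiv
  have hc' : Continuous f' := by
    have := continuous_eval q
    have := continuous_evalDeriv q
    fun_prop
  have hC1 : ContDiff ℝ 1 f :=
    contDiff_one_iff_fderiv.2 ⟨fun u => (hd u).differentiableAt, hfd ▸ hc'⟩
  have hcos : PolyGrowth fun u : ι → ℝ => Real.cos (u b + α) :=
    PolyGrowth.of_bounded (C := 1) fun u => Real.abs_cos_le_one _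
  have hsin : PolyGrowth fun u : ι → ℝ => -Real.sin (u b + α) :=
    PolyGrowth.of_bounded (C := 1) fun u => by
      rw [norm_neg]; exact Real.abs_sin_le_one _
  have hg0 : PolyGrowth f := (polyGrowth_eval q).smul hcos
  have hg1 : PolyGrowth (fderiv ℝ f) := by
    rw [hfd]
    exact ((polyGrowth_eval q).smul (hsin.smul (PolyGrowth.of_bounded
      (C := ‖(ContinuousLinearMap.proj b : (ι → ℝ) →L[ℝ] ℝ)‖) fun _ => le_rfl))).add
      (hcos.smul (polyGrowth_evalDeriv q))
  obtain ⟨C, k, h0, h1⟩ := hg0.exists_common hg1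
  have h := integral_fderiv_gaussVec g hC1 h0 h1 j
  rw [hfd] at h
  refine Eq.trans (integral_congr_ae (ae_of_all _ fun x => ?_)) h
  simp only [hf', add_apply, smul_apply, evalDeriv_apply, smul_eq_mul,
    ContinuousLinearMap.proj_apply]
  ring

theorem memLp_poly_gaussVec (g : ι → gaussHilbert γ) (q : MvPolynomial ι ℝ) :
    MemLp (fun x => MvPolynomial.eval (gaussVec g x) q) 2 γ := by
  obtain ⟨C, k, -, h⟩ := polyGrowth_eval q
  exact memLp_comp_gaussVec g (continuous_eval q) h

end PolynomialCalculus

/-! ### Uniqueness of Fourier coefficients on a separable Hilbert space. -/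

section Uniqueness

variable {X : Type u} [NormedAddCommGroup X] [InnerProductSpace ℝ X] [CompleteSpace X]
  [SecondCountableTopology X] [MeasurableSpace X] [BorelSpace X]

theorem integral_cexp_eq_zero {γ : Measure X} {F : X → ℝ} (hF : Integrable F γ)
    (h : ∀ (w : X) (α : ℝ), ∫ x, F x * Real.cos (inner ℝ w x + α) ∂γ = 0) (w : X) :
    ∫ x, (F x : ℂ) * Complex.exp (inner ℝ x w * Complex.I) ∂γ = 0 := by
  have hi : ∀ α : ℝ, Integrable (fun x => F x * Real.cos (inner ℝ w x + α)) γ := fun α =>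
    hF.mul_bdd (c := 1) (by fun_prop) (ae_of_all _ fun x => Real.abs_cos_le_one _)
  -- The phases `0` and `-π/2` give the real and imaginary parts of the exponential.
  have h1 : ∀ x, (F x : ℂ) * Complex.exp (inner ℝ x w * Complex.I)
      = ((F x * Real.cos (inner ℝ w x + 0) : ℝ) : ℂ)
        + ((F x * Real.cos (inner ℝ w x + -(Real.pi / 2)) : ℝ) : ℂ) * Complex.I := fun x => by
    rw [Complex.exp_mul_I, ← sub_eq_add_neg, Real.cos_sub_pi_div_two, add_zero,
      real_inner_comm]
    push_cast
    ring
  simp_rw [h1]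
  rw [integral_add (hi 0).ofReal ((hi _).ofReal.mul_const _), integral_mul_const,
    integral_complex_ofReal, integral_complex_ofReal, h, h]
  simp

theorem toReal_ofReal_sub_toReal_ofReal_neg (a : ℝ) :
    (ENNReal.ofReal a).toReal - (ENNReal.ofReal (-a)).toReal = a := by
  rcases le_total 0 a with h | h
  · rw [ENNReal.toReal_ofReal h, ENNReal.ofReal_of_nonpos (by linarith)]; simp
  · rw [ENNReal.toReal_ofReal (by linarith : 0 ≤ -a), ENNReal.ofReal_of_nonpos h]; simp

/-- An integrable function on a separable Hilbert space all of whose Fourier coefficients vanish is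
zero almost everywhere. -/
theorem ae_eq_zero_of_integral_cos {γ : Measure X} {F : X → ℝ} (hF : Integrable F γ)
    (h : ∀ (w : X) (α : ℝ), ∫ x, F x * Real.cos (inner ℝ w x + α) ∂γ = 0) : F =ᵐ[γ] 0 := by
  have := isFiniteMeasure_withDensity_ofReal hF.2
  have := isFiniteMeasure_withDensity_ofReal hF.neg.2
  have hm : AEMeasurable (fun x => ENNReal.ofReal (F x)) γ := hF.1.aemeasurable.ennreal_ofReal
  have hm' : AEMeasurable (fun x => ENNReal.ofReal ((-F) x)) γ :=
    hF.neg.1.aemeasurable.ennreal_ofReal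
  have hi : ∀ (G : X → ℝ), Integrable G γ → ∀ w, Integrable (fun x =>
      (ENNReal.ofReal (G x)).toReal • Complex.exp (inner ℝ x w * Complex.I)) γ := fun G hG w => by
    have h1 : Integrable (fun x => (ENNReal.ofReal (G x)).toReal) γ :=
      hG.mono hG.1.aemeasurable.ennreal_ofReal.ennreal_toReal.aestronglyMeasurable
        (ae_of_all _ fun x => by
          rw [ENNReal.toReal_ofReal', Real.norm_eq_abs, Real.norm_eq_abs]
          rcases le_total 0 (G x) with h | h
          · rw [max_eq_left h]
          · rw [max_eq_right h]; simp)
    refine h1.smul_bdd (f := fun x => Complex.exp (inner ℝ x w * Complex.I)) 1 (by fun_prop)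
      (ae_of_all _ fun x => ?_)
    rw [Complex.norm_exp_ofReal_mul_I]
  -- The positive and negative parts of `F` are densities of two finite measures; their
  -- characteristic functions differ by a Fourier coefficient of `F`, which is zero.
  have heq : γ.withDensity (fun x => ENNReal.ofReal (F x))
      = γ.withDensity (fun x => ENNReal.ofReal ((-F) x)) := by
    refine Measure.ext_of_charFun (funext fun w => ?_)
    rw [charFun_apply, charFun_apply,
      integral_withDensity_eq_integral_toReal_smul₀ hm (ae_of_all _ fun _ => by simp),
      integral_withDensity_eq_integral_toReal_smul₀ hm' (ae_of_all _ fun _ => by simp),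
      ← sub_eq_zero, ← integral_sub (hi F hF w) (hi (-F) hF.neg w)]
    rw [← integral_cexp_eq_zero hF h w]
    refine integral_congr_ae (ae_of_all _ fun x => ?_)
    change _ • _ - _ • _ = _
    rw [← sub_smul, Pi.neg_apply, toReal_ofReal_sub_toReal_ofReal_neg, Complex.real_smul]
  have hfin : ∫⁻ x, ENNReal.ofReal (F x) ∂γ ≠ ∞ := by
    have := measure_ne_top (γ.withDensity fun x => ENNReal.ofReal (F x)) Set.univ
    rwa [withDensity_apply _ MeasurableSet.univ, Measure.restrict_univ] at this
  filter_upwards [(withDensity_eq_iff hm hm' hfin).1 heq] with x hx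
  have := toReal_ofReal_sub_toReal_ofReal_neg (F x)
  rw [hx, Pi.neg_apply, sub_self] at this
  exact this.symm

end Uniqueness

/-! ### White noise and the unitary operator from `X` onto the Cameron-Martin space. -/

section WhiteNoise

variable {X : Type u} [NormedAddCommGroup X] [InnerProductSpace ℝ X] [CompleteSpace X]
  [SecondCountableTopology X] [MeasurableSpace X] [BorelSpace X] {γ : Measure X} [IsGaussian γ]

theorem covSqrt_inner (x y : X) : inner ℝ (covSqrt γ x) y = inner ℝ x (covSqrt γ y) :=
  (opSqrt_isPositive (covarianceOperator γ) isPositive_covarianceOperator).inner_left_eq_inner_right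
    x y

theorem covSqrt_covSqrt (x : X) : covSqrt γ (covSqrt γ x) = covarianceOperator γ x :=
  congrArg (fun T : X →L[ℝ] X => T x)
    (opSqrt_comp_self (covarianceOperator γ) isPositive_covarianceOperator)

theorem covSqrt_injective (hnd : LinearMap.ker (covarianceOperator γ).toLinearMap = ⊥) :
    Function.Injective (covSqrt γ) := by
  refine (injective_iff_map_eq_zero (covSqrt γ)).2 fun x hx => ?_
  have h : x ∈ LinearMap.ker (covarianceOperator γ).toLinearMap := by
    rw [LinearMap.mem_ker]
    change covarianceOperator γ x = 0
    rw [← covSqrt_covSqrt, hx, map_zero]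
  rwa [hnd] at h

theorem norm_whiteNoise (hcent : ∀ f : StrongDual ℝ X, ∫ x, f x ∂γ = 0)
    (hnd : LinearMap.ker (covarianceOperator γ).toLinearMap = ⊥) (z : X) :
    ‖whiteNoise γ z‖ = ‖z‖ := by
  refine (denseRange_covSqrt γ hnd).induction_on (p := fun z => ‖whiteNoise γ z‖ = ‖z‖) z ?_ ?_
  · exact isClosed_eq (by fun_prop) (by fun_prop)
  · intro y
    rw [whiteNoise_covSqrt γ hcent hnd, norm_emb_eq γ hcent]

/-- The range is closed because the map is an isometry, and it contains the dense subspace `j(X*)`.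
-/
theorem whiteNoise_surjective (hcent : ∀ f : StrongDual ℝ X, ∫ x, f x ∂γ = 0)
    (hnd : LinearMap.ker (covarianceOperator γ).toLinearMap = ⊥) :
    Function.Surjective (whiteNoise γ) := by
  have hi : Isometry (whiteNoise γ) :=
    AddMonoidHomClass.isometry_of_norm _ (norm_whiteNoise hcent hnd)
  have hr : Set.range (emb γ) ⊆ Set.range (whiteNoise γ) := by
    rintro _ ⟨f, rfl⟩
    refine ⟨covSqrt γ ((InnerProductSpace.toDual ℝ X).symm f), ?_⟩
    rw [whiteNoise_covSqrt γ hcent hnd]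
    congr 1
    exact (InnerProductSpace.toDual ℝ X).apply_symm_apply f
  have hd : Dense (Set.range (whiteNoise γ)) := (denseRange_emb γ).mono hr
  rw [← Set.range_eq_univ, ← hd.closure_eq, hi.isClosedEmbedding.isClosed_range.closure_eq]

theorem whiteNoise_covSqrt_ae (hcent : ∀ f : StrongDual ℝ X, ∫ x, f x ∂γ = 0)
    (hnd : LinearMap.ker (covarianceOperator γ).toLinearMap = ⊥) (y : X) :
    (whiteNoise γ (covSqrt γ y) : Lp ℝ 2 γ) =ᵐ[γ] fun x => inner ℝ y x := by
  rw [whiteNoise_covSqrt γ hcent hnd, emb_coe]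
  filter_upwards [centeredEmb_coe γ (InnerProductSpace.toDualMap ℝ X y)] with x hx
  rw [hx, hcent]
  simp

variable (hcent : ∀ f : StrongDual ℝ X, ∫ x, f x ∂γ = 0)
  (hnd : LinearMap.ker (covarianceOperator γ).toLinearMap = ⊥)

/-- The white noise map as a unitary operator from `X` onto the Gaussian Hilbert space. -/
noncomputable def whiteNoiseIso : X ≃ₗᵢ[ℝ] gaussHilbert γ :=
  LinearIsometryEquiv.ofSurjective
    ⟨(whiteNoise γ).toLinearMap, norm_whiteNoise hcent hnd⟩ (whiteNoise_surjective hcent hnd)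

theorem whiteNoiseIso_apply (z : X) : whiteNoiseIso hcent hnd z = whiteNoise γ z := rfl

/-- The unitary operator from `X` onto the Cameron-Martin space extending `Q^{1/2}`. -/
noncomputable def cameronMartinIso : X ≃ₗᵢ[ℝ] CameronMartin γ :=
  (whiteNoiseIso hcent hnd).trans (CameronMartin.hat γ).symm

theorem hat_cameronMartinIso (z : X) :
    CameronMartin.hat γ (cameronMartinIso hcent hnd z) = whiteNoise γ z :=
  (CameronMartin.hat γ).apply_symm_apply _

/-- Pairing with `y` gives `⟨𝒲_z, j⟨y, ·⟩⟩`; since `j⟨y, ·⟩` is the white noise of `Q^{1/2} y`,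
unitarity turns this into `⟨z, Q^{1/2} y⟩`. -/
theorem incl_cameronMartinIso (z : X) :
    CameronMartin.incl γ (cameronMartinIso hcent hnd z) = covSqrt γ z := by
  refine ext_inner_left ℝ fun y => ?_
  have h := CameronMartin.dual_incl γ (cameronMartinIso hcent hnd z)
    (InnerProductSpace.toDualMap ℝ X y)
  rw [hat_cameronMartinIso, ← whiteNoise_covSqrt γ hcent hnd, ← whiteNoiseIso_apply hcent hnd,
    ← whiteNoiseIso_apply hcent hnd, LinearIsometryEquiv.inner_map_map] at h
  rw [← covSqrt_inner, real_inner_comm z, ← h]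
  rfl

/-- The derivative along `H` tested on the image of `z` is the derivative of `f` in the direction
`Q^{1/2} z`, by the chain rule and `incl_cameronMartinIso`. -/
theorem gradH_eq {f : X → ℝ} {x : X} (hf : DifferentiableAt ℝ f x) :
    gradH γ f x = cameronMartinIso hcent hnd (covSqrt γ (∇ f x)) := by
  refine ext_inner_right ℝ fun h => ?_
  obtain ⟨z, rfl⟩ := (cameronMartinIso hcent hnd).surjective h
  rw [LinearIsometryEquiv.inner_map_map, covSqrt_inner, ← incl_cameronMartinIso hcent hnd]
  have h1 : HasFDerivAt (fun h : CameronMartin γ => f (x + CameronMartin.incl γ h))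
      ((fderiv ℝ f x).comp (CameronMartin.inclL γ)) 0 := by
    have h2 : HasFDerivAt (fun h : CameronMartin γ => x + CameronMartin.inclL γ h)
        (CameronMartin.inclL γ) 0 := (CameronMartin.inclL γ).hasFDerivAt.const_add x
    have h3 : HasFDerivAt f (fderiv ℝ f x) (x + CameronMartin.inclL γ 0) := by
      rw [map_zero, add_zero]; exact hf.hasFDerivAt
    exact h3.comp (0 : CameronMartin γ) h2
  rw [gradH, gradient, gradient, InnerProductSpace.toDual_symm_apply,
    InnerProductSpace.toDual_symm_apply, h1.fderiv]
  rfl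

end WhiteNoise

/-! ### Test functions of one linear functional. -/

section CylindricalFunctions

variable {X : Type u} [NormedAddCommGroup X] [InnerProductSpace ℝ X]

theorem Cb1.mul {f g : X → ℝ} (hf : f ∈ Cb1 X) (hg : g ∈ Cb1 X) :
    (fun x => f x * g x) ∈ Cb1 X := by
  obtain ⟨h1, ⟨A, hA⟩, ⟨B, hB⟩⟩ := hf
  obtain ⟨h1', ⟨A', hA'⟩, ⟨B', hB'⟩⟩ := hg
  refine ⟨h1.mul h1', ⟨A * A', fun x => ?_⟩, ⟨A * B' + A' * B, fun x => ?_⟩⟩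
  · rw [abs_mul]
    exact mul_le_mul (hA x) (hA' x) (abs_nonneg _) ((abs_nonneg _).trans (hA x))
  · rw [fderiv_fun_mul (h1.differentiable one_ne_zero x) (h1'.differentiable one_ne_zero x)]
    refine (norm_add_le _ _).trans (add_le_add ?_ ?_)
    · rw [norm_smul]
      exact mul_le_mul (hA x) (hB' x) (norm_nonneg _) ((abs_nonneg _).trans (hA x))
    · rw [norm_smul]
      exact mul_le_mul (hA' x) (hB x) (norm_nonneg _) ((abs_nonneg _).trans (hA' x))

theorem hasFDerivAt_comp_inner {g g' : ℝ → ℝ} (hg : ∀ s, HasDerivAt g (g' s) s) (w x : X) :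
    HasFDerivAt (fun x => g (inner ℝ w x)) (g' (inner ℝ w x) • innerSL ℝ w) x :=
  (hg _).comp_hasFDerivAt x (innerSL ℝ w).hasFDerivAt

theorem Cb1.comp_inner {g g' : ℝ → ℝ} (hg : ∀ s, HasDerivAt g (g' s) s) (hc : Continuous g')
    {A B : ℝ} (hA : ∀ s, |g s| ≤ A) (hB : ∀ s, |g' s| ≤ B) (w : X) :
    (fun x => g (inner ℝ w x)) ∈ Cb1 X := by
  have hd : fderiv ℝ (fun x => g (inner ℝ w x)) = fun x => g' (inner ℝ w x) • innerSL ℝ w :=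
    funext fun x => (hasFDerivAt_comp_inner hg w x).fderiv
  refine ⟨contDiff_one_iff_fderiv.2
    ⟨fun x => (hasFDerivAt_comp_inner hg w x).differentiableAt, ?_⟩,
    ⟨A, fun x => hA _⟩, ⟨B * ‖innerSL ℝ w‖, fun x => ?_⟩⟩
  · rw [hd]; fun_prop
  · rw [hd, norm_smul]
    gcongr
    exact hB _

theorem hasDerivAt_cos_add (α s : ℝ) :
    HasDerivAt (fun s => Real.cos (s + α)) (-Real.sin (s + α)) s := by
  simpa using ((hasDerivAt_id s).add_const α).cos

theorem cos_inner_mem_Cb1 (w : X) (α : ℝ) : (fun x => Real.cos (inner ℝ w x + α)) ∈ Cb1 X :=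
  Cb1.comp_inner (g := fun s => Real.cos (s + α)) (hasDerivAt_cos_add α) (by fun_prop)
    (fun _ => Real.abs_cos_le_one _) (fun _ => by rw [abs_neg]; exact Real.abs_sin_le_one _) w

theorem hasFDerivAt_cos_inner (w : X) (α : ℝ) (x : X) :
    HasFDerivAt (fun x => Real.cos (inner ℝ w x + α))
      (-Real.sin (inner ℝ w x + α) • innerSL ℝ w) x :=
  hasFDerivAt_comp_inner (g := fun s => Real.cos (s + α)) (hasDerivAt_cos_add α) w x

theorem hasDerivAt_inv_one_add_sq (s : ℝ) :
    HasDerivAt (fun s : ℝ => (1 + s ^ 2)⁻¹) (-(2 * s) / (1 + s ^ 2) ^ 2) s := by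
  have h : HasDerivAt (fun s : ℝ => 1 + s ^ 2) (2 * s) s := by
    simpa using (hasDerivAt_pow 2 s).const_add 1
  exact h.inv (by positivity)

/-- This weight stays bounded after multiplication by `⟨y, x⟩`, the unbounded factor in integration
by parts. -/
theorem inv_one_add_inner_sq_mem_Cb1 (y : X) : (fun x => (1 + inner ℝ y x ^ 2)⁻¹) ∈ Cb1 X := by
  refine Cb1.comp_inner (g := fun s : ℝ => (1 + s ^ 2)⁻¹) (A := 1) (B := 1)
    hasDerivAt_inv_one_add_sq ?_ (fun s => ?_) (fun s => ?_) y
  · exact Continuous.div (by fun_prop) (by fun_prop) fun s => by positivity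
  · rw [abs_of_nonneg (by positivity)]
    exact inv_le_one_of_one_le₀ (by nlinarith [sq_nonneg s])
  · rw [abs_div, abs_neg, abs_of_nonneg (by positivity : (0 : ℝ) ≤ (1 + s ^ 2) ^ 2),
      div_le_one (by positivity), abs_le]
    constructor <;> nlinarith [sq_nonneg (s + 1), sq_nonneg (s - 1), sq_nonneg (s ^ 2)]

end CylindricalFunctions

/-! ### Integration by parts for `Q^{1/2}∇`. -/

section IntegrationByParts

variable {X : Type u} [NormedAddCommGroup X] [InnerProductSpace ℝ X] [CompleteSpace X]
  [SecondCountableTopology X] [MeasurableSpace X] [BorelSpace X] {γ : Measure X} [IsGaussian γ]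

/-- The product `f ψ` is differentiated in the direction `Q y`; `⟨Q^{1/2} y, Q^{1/2} ∇f⟩` is the
derivative of `f` along `Q y`. -/
theorem integral_mul_inner_sqrtGrad (hcent : ∀ f : StrongDual ℝ X, ∫ x, f x ∂γ = 0) {f ψ : X → ℝ}
    (hf : f ∈ Cb1 X) (hψ : ψ ∈ Cb1 X) (y : X) :
    ∫ x, ψ x * inner ℝ (covSqrt γ y) (covSqrt γ (∇ f x)) ∂γ
      = ∫ x, f x * (ψ x * inner ℝ y x - fderiv ℝ ψ x (covarianceOperator γ y)) ∂γ := by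
  have hm := Cb1.mul hf hψ
  obtain ⟨hf1, ⟨A, hA⟩, ⟨B, hB⟩⟩ := hf
  obtain ⟨hψ1, ⟨A', hA'⟩, ⟨B', hB'⟩⟩ := hψ
  obtain ⟨hm1, ⟨A'', hA''⟩, ⟨B'', hB''⟩⟩ := hm
  obtain ⟨C, k, h0, h1⟩ := (PolyGrowth.of_bounded (f := fun x => f x * ψ x) hA'').exists_common
    (PolyGrowth.of_bounded hB'')
  have hQ : ∫ z, InnerProductSpace.toDualMap ℝ X y z • z ∂γ = covarianceOperator γ y := by
    rw [covarianceOperator_apply IsGaussian.memLp_two_id]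
    simp
  have h := integral_fderiv_apply_eq γ hcent hm1 h0 h1 (InnerProductSpace.toDualMap ℝ X y)
  rw [hQ] at h
  have hfc := hf1.continuous
  have hψc := hψ1.continuous
  have hfc' := hf1.continuous_fderiv one_ne_zero
  have hψc' := hψ1.continuous_fderiv one_ne_zero
  have e1 : ∀ x, fderiv ℝ (fun x => f x * ψ x) x (covarianceOperator γ y)
      = ψ x * fderiv ℝ f x (covarianceOperator γ y)
        + f x * fderiv ℝ ψ x (covarianceOperator γ y) := fun x => by
    rw [fderiv_fun_mul (hf1.differentiable one_ne_zero x) (hψ1.differentiable one_ne_zero x)]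
    simp only [add_apply, smul_apply, smul_eq_mul]
    ring
  have e2 : ∀ x, inner ℝ (covSqrt γ y) (covSqrt γ (∇ f x))
      = fderiv ℝ f x (covarianceOperator γ y) := fun x => by
    rw [← covSqrt_inner, covSqrt_covSqrt, real_inner_comm, gradient,
      InnerProductSpace.toDual_symm_apply]
  have i1 : Integrable (fun x => ψ x * fderiv ℝ f x (covarianceOperator γ y)) γ := by
    refine Integrable.of_bound (C := A' * (B * ‖covarianceOperator γ y‖)) ?_
      (ae_of_all _ fun x => ?_)
    · exact (hψc.mul (hfc'.clm_apply continuous_const)).aestronglyMeasurable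
    · rw [norm_mul]
      exact mul_le_mul (hA' x) ((ContinuousLinearMap.le_opNorm _ _).trans (by gcongr; exact hB x))
        (norm_nonneg _) ((abs_nonneg _).trans (hA' x))
  have i2 : Integrable (fun x => f x * fderiv ℝ ψ x (covarianceOperator γ y)) γ := by
    refine Integrable.of_bound (C := A * (B' * ‖covarianceOperator γ y‖)) ?_
      (ae_of_all _ fun x => ?_)
    · exact (hfc.mul (hψc'.clm_apply continuous_const)).aestronglyMeasurable
    · rw [norm_mul]
      exact mul_le_mul (hA x) ((ContinuousLinearMap.le_opNorm _ _).trans (by gcongr; exact hB' x))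
        (norm_nonneg _) ((abs_nonneg _).trans (hA x))
  have i3 : Integrable (fun x => f x * ψ x * InnerProductSpace.toDualMap ℝ X y x) γ :=
    (IsGaussian.integrable_dual γ (InnerProductSpace.toDualMap ℝ X y)).bdd_mul (c := A'')
      (hfc.mul hψc).aestronglyMeasurable (ae_of_all _ hA'')
  simp_rw [e1] at h
  rw [integral_add i1 i2] at h
  simp_rw [e2]
  rw [eq_sub_of_add_eq h, ← integral_sub i3 i2]
  refine integral_congr_ae (ae_of_all _ fun x => ?_)
  simp only [InnerProductSpace.toDualMap_apply_apply]
  ring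

end IntegrationByParts

/-! ### Closability of `Q^{1/2}∇` on every `L^p`. -/

section Closability

variable {X : Type u} [NormedAddCommGroup X] [InnerProductSpace ℝ X] [CompleteSpace X]
  [SecondCountableTopology X] [MeasurableSpace X] [BorelSpace X] {γ : Measure X} [IsGaussian γ]

/-- Integration of `L^p` functions against a bounded scalar weight is a continuous functional. -/
theorem exists_clm_integral_mul {Ω : Type*} [MeasurableSpace Ω] (P : Measure Ω)
    [IsProbabilityMeasure P] {E : Type*} [NormedAddCommGroup E] [NormedSpace ℝ E] (p : ℝ≥0∞)
    [hp : Fact (1 ≤ p)] (L : E →L[ℝ] ℝ) {b : Ω → ℝ} (hb : AEStronglyMeasurable b P) {C : ℝ}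
    (hC : ∀ x, |b x| ≤ C) :
    ∃ T : Lp E p P →L[ℝ] ℝ, ∀ G, T G = ∫ x, b x * L (G x) ∂P := by
  have hi : ∀ G : Lp E p P, Integrable (fun x => b x * L (G x)) P := fun G =>
    (L.integrable_comp ((Lp.memLp G).integrable hp.out)).bdd_mul hb (ae_of_all _ hC)
  refine ⟨LinearMap.mkContinuous
    { toFun := fun G => ∫ x, b x * L (G x) ∂P
      map_add' := fun F G => ?_
      map_smul' := fun c G => ?_ } (C * ‖L‖) fun G => ?_, fun G => rfl⟩
  · rw [← integral_add (hi F) (hi G)]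
    refine integral_congr_ae ?_
    filter_upwards [Lp.coeFn_add F G] with x hx
    rw [hx, Pi.add_apply, map_add, mul_add]
  · rw [RingHom.id_apply, smul_eq_mul, ← integral_const_mul]
    refine integral_congr_ae ?_
    filter_upwards [Lp.coeFn_smul c G] with x hx
    rw [hx, Pi.smul_apply, map_smul, smul_eq_mul]
    ring
  · change ‖∫ x, b x * L (G x) ∂P‖ ≤ _
    have hG := ((Lp.memLp G).integrable hp.out).norm
    have h : ∀ x, ‖b x * L (G x)‖ ≤ C * ‖L‖ * ‖G x‖ := fun x => by
      rw [norm_mul, mul_assoc]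
      exact mul_le_mul (hC x) (L.le_opNorm _) (norm_nonneg _) ((abs_nonneg _).trans (hC x))
    refine (norm_integral_le_of_norm_le (hG.const_mul (C * ‖L‖)) (ae_of_all _ h)).trans ?_
    rw [integral_const_mul]
    rcases isEmpty_or_nonempty Ω with hΩ | ⟨⟨x⟩⟩
    · have : P = 0 := Measure.eq_zero_of_isEmpty P
      exact absurd this (IsProbabilityMeasure.ne_zero P)
    · have : 0 ≤ C := (abs_nonneg _).trans (hC x)
      gcongr
      exact integral_norm_le_norm_Lp hp.out G

/-- Self-adjointness moves `Q^{1/2}` onto `G`, and injectivity removes it. -/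
theorem ae_eq_zero_of_inner_covSqrt
    (hnd : LinearMap.ker (covarianceOperator γ).toLinearMap = ⊥) {G : X → X}
    (h : ∀ y, (fun x => inner ℝ (covSqrt γ y) (G x)) =ᵐ[γ] 0) : G =ᵐ[γ] 0 := by
  have h1 : (fun x => covSqrt γ (G x)) =ᵐ[γ] 0 := by
    refine ae_eq_zero_of_forall_inner (𝕜 := ℝ) fun y => ?_
    filter_upwards [h y] with x hx
    rw [← covSqrt_inner]
    exact hx
  filter_upwards [h1] with x hx
  exact covSqrt_injective hnd (by rw [hx]; simp)

/-- `Q^{1/2}∇` is closable on `L^p` for every `p`. -/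
theorem snd_eq_zero_of_mem_closure_smoothGraph (hcent : ∀ f : StrongDual ℝ X, ∫ x, f x ∂γ = 0)
    (hnd : LinearMap.ker (covarianceOperator γ).toLinearMap = ⊥) (p : ℝ≥0∞) [hp : Fact (1 ≤ p)]
    {G : Lp X p γ}
    (hG : ((0 : Lp ℝ p γ), G) ∈ (smoothGraph γ p (sqrtGradLin γ)).topologicalClosure) : G = 0 := by
  rw [Lp.eq_zero_iff_ae_eq_zero]
  refine ae_eq_zero_of_inner_covSqrt hnd fun y => ?_
  have hGi : Integrable (fun x => inner ℝ (covSqrt γ y) (G x)) γ :=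
    ((innerSL ℝ (covSqrt γ y)).integrable_comp ((Lp.memLp G).integrable hp.out))
  have hb : ∀ x : X, |(1 + inner ℝ y x ^ 2)⁻¹| ≤ 1 := fun x => by
    rw [abs_of_nonneg (by positivity)]
    exact inv_le_one_of_one_le₀ (by nlinarith [sq_nonneg (inner ℝ y x)])
  have hbc : Continuous fun x : X => (1 + inner ℝ y x ^ 2)⁻¹ :=
    Continuous.inv₀ (by fun_prop) fun x => by positivity
  have key : (fun x => inner ℝ (covSqrt γ y) (G x) * (1 + inner ℝ y x ^ 2)⁻¹) =ᵐ[γ] 0 := by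
    refine ae_eq_zero_of_integral_cos
      (hGi.mul_bdd (c := 1) hbc.aestronglyMeasurable (ae_of_all _ hb)) fun w α => ?_
    set ψ : X → ℝ := fun x => Real.cos (inner ℝ w x + α) * (1 + inner ℝ y x ^ 2)⁻¹ with hψd
    have hψ : ψ ∈ Cb1 X := Cb1.mul (cos_inner_mem_Cb1 w α) (inv_one_add_inner_sq_mem_Cb1 y)
    obtain ⟨hψ1, ⟨A, hA⟩, ⟨B, hB⟩⟩ := id hψ
    set κ : X → ℝ := fun x => ψ x * inner ℝ y x - fderiv ℝ ψ x (covarianceOperator γ y) with hκd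
    have hψc := hψ1.continuous
    have hκc : Continuous κ :=
      (hψc.mul (by fun_prop)).sub ((hψ1.continuous_fderiv one_ne_zero).clm_apply continuous_const)
    -- Since `|s| / (1 + s²) ≤ 1`, the weight makes `κ` bounded, so `F ↦ ∫ F κ dγ` is continuous on
    -- `L^p` even for `p = 1`.
    have hκ : ∀ x, |κ x| ≤ 1 + B * ‖covarianceOperator γ y‖ := fun x => by
      refine (abs_sub _ _).trans (add_le_add ?_ ?_)
      · rw [hψd]
        change |Real.cos _ * _ * _| ≤ 1
        rw [abs_mul, abs_mul, abs_of_nonneg (by positivity : (0 : ℝ) ≤ (1 + inner ℝ y x ^ 2)⁻¹),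
          mul_assoc]
        refine mul_le_one₀ (Real.abs_cos_le_one _) (by positivity) ?_
        rw [inv_mul_le_iff₀ (by positivity), mul_one]
        nlinarith [sq_abs (inner ℝ y x), sq_nonneg (|inner ℝ y x| - 1), abs_nonneg (inner ℝ y x)]
      · exact (ContinuousLinearMap.le_opNorm _ _).trans (mul_le_mul_of_nonneg_right (hB x) (norm_nonneg _))
    obtain ⟨T₁, hT₁⟩ := exists_clm_integral_mul γ p (innerSL ℝ (covSqrt γ y))
      hψc.aestronglyMeasurable hA
    obtain ⟨T₂, hT₂⟩ := exists_clm_integral_mul γ p (ContinuousLinearMap.id ℝ ℝ)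
      hκc.aestronglyMeasurable hκ
    -- Integration by parts is a closed condition on pairs, so it passes from the graph to its
    -- closure and applies to `(0, G)`.
    have hcl : IsClosed {u : Lp ℝ p γ × Lp X p γ | T₁ u.2 = T₂ u.1} :=
      isClosed_eq (by fun_prop) (by fun_prop)
    have hsub : (smoothGraph γ p (sqrtGradLin γ) : Set (Lp ℝ p γ × Lp X p γ))
        ⊆ {u | T₁ u.2 = T₂ u.1} := by
      rintro u ⟨f, hf, hf'⟩
      rw [Set.mem_ofPred_eq, hT₁, hT₂]
      refine Eq.trans (integral_congr_ae ?_)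
        ((integral_mul_inner_sqrtGrad hcent f.2 hψ y).trans (integral_congr_ae ?_))
      · filter_upwards [hf'] with x hx
        rw [hx]
        rfl
      · filter_upwards [hf] with x hx
        rw [hx, mul_comm]
        rfl
    have h0 := closure_minimal hsub hcl hG
    rw [Set.mem_ofPred_eq] at h0
    change T₁ G = T₂ 0 at h0
    rw [map_zero, hT₁] at h0
    rw [← h0]
    refine integral_congr_ae (ae_of_all _ fun x => ?_)
    simp only [hψd, innerSL_apply_apply]
    ring
  filter_upwards [key] with x hx
  exact (mul_eq_zero.1 hx).resolve_right (by positivity)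

end Closability

/-! ### The weak derivative in `L²` and the density of trigonometric functions. -/

section WeakDerivative

open Filter Topology

variable {X : Type u} [NormedAddCommGroup X] [InnerProductSpace ℝ X] [CompleteSpace X]
  [SecondCountableTopology X] [MeasurableSpace X] [BorelSpace X] (γ : Measure X) [IsGaussian γ]

theorem memLp_inner_left (y : X) : MemLp (fun x => inner ℝ y x) 2 γ :=
  IsGaussian.memLp_dual γ (innerSL ℝ y) 2 (by simp)

theorem memLp_cos_inner (w : X) (α : ℝ) : MemLp (fun x => Real.cos (inner ℝ w x + α)) 2 γ :=
  MemLp.of_bound (by fun_prop) 1 (ae_of_all _ fun _ => Real.abs_cos_le_one _)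

theorem memLp_cos_smul (y w : X) (α : ℝ) :
    MemLp (fun x => Real.cos (inner ℝ w x + α) • covSqrt γ y) 2 γ :=
  MemLp.of_bound (by fun_prop) ‖covSqrt γ y‖ (ae_of_all _ fun _ => by
    rw [norm_smul]
    exact mul_le_of_le_one_left (norm_nonneg _) (Real.abs_cos_le_one _))

theorem memLp_div_cos (y w : X) (α : ℝ) :
    MemLp (fun x => Real.cos (inner ℝ w x + α) * inner ℝ y x
      + Real.sin (inner ℝ w x + α) * inner ℝ (covSqrt γ w) (covSqrt γ y)) 2 γ := by
  refine MemLp.add ?_ ?_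
  · refine (memLp_inner_left γ y).mono (by fun_prop) (ae_of_all _ fun x => ?_)
    rw [norm_mul]
    exact mul_le_of_le_one_left (norm_nonneg _) (Real.abs_cos_le_one _)
  · refine MemLp.of_bound (by fun_prop) ‖inner ℝ (covSqrt γ w) (covSqrt γ y)‖
      (ae_of_all _ fun _ => ?_)
    rw [norm_mul]
    exact mul_le_of_le_one_left (norm_nonneg _) (Real.abs_sin_le_one _)

/-- The trigonometric function `cos (⟨w, ·⟩ + α)` in `L²`. -/
noncomputable def cosLp (w : X) (α : ℝ) : Lp ℝ 2 γ := (memLp_cos_inner γ w α).toLp _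

/-- The vector field `cos (⟨w, ·⟩ + α) Q^{1/2} y` in `L²`. -/
noncomputable def cosFieldLp (y w : X) (α : ℝ) : Lp X 2 γ := (memLp_cos_smul γ y w α).toLp _

/-- The Gaussian divergence of the vector field `cos (⟨w, ·⟩ + α) Q^{1/2} y`. -/
noncomputable def divCosLp (y w : X) (α : ℝ) : Lp ℝ 2 γ := (memLp_div_cos γ y w α).toLp _

theorem inner_cosLp (w : X) (α : ℝ) (F : Lp ℝ 2 γ) :
    inner ℝ (cosLp γ w α) F = ∫ x, F x * Real.cos (inner ℝ w x + α) ∂γ := by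
  rw [L2.inner_def]
  refine integral_congr_ae ?_
  filter_upwards [(memLp_cos_inner γ w α).coeFn_toLp] with x hx
  rw [cosLp, hx]
  simp

theorem inner_cosFieldLp (y w : X) (α : ℝ) (G : Lp X 2 γ) :
    inner ℝ (cosFieldLp γ y w α) G
      = ∫ x, Real.cos (inner ℝ w x + α) * inner ℝ (covSqrt γ y) (G x) ∂γ := by
  rw [L2.inner_def]
  refine integral_congr_ae ?_
  filter_upwards [(memLp_cos_smul γ y w α).coeFn_toLp] with x hx
  rw [cosFieldLp, hx, real_inner_smul_left]

theorem inner_divCosLp (y w : X) (α : ℝ) (F : Lp ℝ 2 γ) :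
    inner ℝ (divCosLp γ y w α) F = ∫ x, F x * (Real.cos (inner ℝ w x + α) * inner ℝ y x
      + Real.sin (inner ℝ w x + α) * inner ℝ (covSqrt γ w) (covSqrt γ y)) ∂γ := by
  rw [L2.inner_def]
  refine integral_congr_ae ?_
  filter_upwards [(memLp_div_cos γ y w α).coeFn_toLp] with x hx
  rw [divCosLp, hx]
  simp

/-- The graph of the weak derivative: pairs `(F, G)` that satisfy integration by parts against
trigonometric vector fields. -/
noncomputable def weakGraph : Submodule ℝ (Lp ℝ 2 γ × Lp X 2 γ) where
  carrier := {u | ∀ (y w : X) (α : ℝ),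
    inner ℝ (cosFieldLp γ y w α) u.2 = inner ℝ (divCosLp γ y w α) u.1}
  zero_mem' := fun y w α => by simp
  add_mem' := fun {u v} hu hv y w α => by
    rw [Prod.snd_add, Prod.fst_add, inner_add_right, inner_add_right, hu, hv]
  smul_mem' := fun c u hu y w α => by
    rw [Prod.smul_snd, Prod.smul_fst, inner_smul_right, inner_smul_right, hu]

variable {γ}

theorem mem_weakGraph {u : Lp ℝ 2 γ × Lp X 2 γ} : u ∈ weakGraph γ ↔ ∀ (y w : X) (α : ℝ),
    inner ℝ (cosFieldLp γ y w α) u.2 = inner ℝ (divCosLp γ y w α) u.1 := Iff.rfl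

theorem isClosed_weakGraph : IsClosed (weakGraph γ : Set (Lp ℝ 2 γ × Lp X 2 γ)) := by
  have h : (weakGraph γ : Set (Lp ℝ 2 γ × Lp X 2 γ)) = ⋂ (y : X) (w : X) (α : ℝ),
      {u | inner ℝ (cosFieldLp γ y w α) u.2 = inner ℝ (divCosLp γ y w α) u.1} := by
    ext u
    simp only [Set.mem_iInter]
    exact mem_weakGraph
  rw [h]
  exact isClosed_iInter fun y => isClosed_iInter fun w => isClosed_iInter fun α =>
    isClosed_eq (by fun_prop) (by fun_prop)

/-- With zero first component, the weak identity says that all Fourier coefficients of `⟨Q^{1/2} y,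
G⟩` vanish. -/
theorem snd_eq_zero_of_mem_weakGraph
    (hnd : LinearMap.ker (covarianceOperator γ).toLinearMap = ⊥) {G : Lp X 2 γ}
    (h : ((0 : Lp ℝ 2 γ), G) ∈ weakGraph γ) : G = 0 := by
  rw [Lp.eq_zero_iff_ae_eq_zero]
  refine ae_eq_zero_of_inner_covSqrt hnd fun y => ?_
  refine ae_eq_zero_of_integral_cos
    ((innerSL ℝ (covSqrt γ y)).integrable_comp ((Lp.memLp G).integrable one_le_two)) fun w α => ?_
  have h1 := mem_weakGraph.1 h y w α
  rw [inner_zero_right, inner_cosFieldLp] at h1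
  rw [← h1]
  exact integral_congr_ae (ae_of_all _ fun x => mul_comm _ _)

/-- If a weakly differentiable `F` is orthogonal in the graph inner product to all trigonometric
functions, then all Fourier coefficients of `F` vanish. -/
theorem integral_mul_cos_eq_zero {F : Lp ℝ 2 γ}
    (h : ∀ (w : X) (α : ℝ), inner ℝ (cosLp γ w α) F
      + inner ℝ (divCosLp γ w w (α + Real.pi / 2)) F = 0) (w : X) (α : ℝ) :
    ∫ x, F x * Real.cos (inner ℝ w x + α) ∂γ = 0 := by
  have hF2 := Lp.memLp F
  have hFi : Integrable F γ := hF2.integrable one_le_two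
  have hFw : Integrable (fun x => F x * inner ℝ w x) γ :=
    hF2.integrable_mul (memLp_inner_left γ w)
  set σ : ℝ := inner ℝ (covSqrt γ w) (covSqrt γ w) with hσ
  set c : ℝ → ℝ := fun t => ∫ x, F x * Real.cos (t * inner ℝ w x + α) ∂γ with hc
  set d : ℝ → ℝ := fun t => ∫ x, F x * (-Real.sin (t * inner ℝ w x + α) * inner ℝ w x) ∂γ with hd
  have hcm : ∀ t : ℝ, Continuous fun x : X => Real.cos (t * inner ℝ w x + α) := fun t => by
    fun_prop
  have hsm : ∀ t : ℝ, Continuous fun x : X => -Real.sin (t * inner ℝ w x + α) * inner ℝ w x :=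
    fun t => by fun_prop
  have hFc : ∀ t : ℝ, Integrable (fun x => F x * Real.cos (t * inner ℝ w x + α)) γ := fun t =>
    hFi.mul_bdd (c := 1) (hcm t).aestronglyMeasurable (ae_of_all _ fun _ => Real.abs_cos_le_one _)
  have hbd : ∀ (t : ℝ) (x : X), ‖F x * (-Real.sin (t * inner ℝ w x + α) * inner ℝ w x)‖
      ≤ ‖F x * inner ℝ w x‖ := fun t x => by
    rw [norm_mul, norm_mul, norm_mul, norm_neg]
    gcongr
    exact mul_le_of_le_one_left (norm_nonneg _) (Real.abs_sin_le_one _)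
  have hFd : ∀ t : ℝ,
      Integrable (fun x => F x * (-Real.sin (t * inner ℝ w x + α) * inner ℝ w x)) γ := fun t =>
    hFw.norm.mono' (hFi.1.mul (hsm t).aestronglyMeasurable) (ae_of_all _ (hbd t))
  have hderiv : ∀ t, HasDerivAt c (d t) t := fun t =>
    (hasDerivAt_integral_of_dominated_loc_of_deriv_le (μ := γ)
      (F := fun t x => F x * Real.cos (t * inner ℝ w x + α))
      (F' := fun t x => F x * (-Real.sin (t * inner ℝ w x + α) * inner ℝ w x)) (x₀ := t)
      (bound := fun x => ‖F x * inner ℝ w x‖) univ_mem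
      (Eventually.of_forall fun t => (hFc t).1) (hFc t) (hFd t).1
      (ae_of_all _ fun x s _ => hbd s x) hFw.norm
      (ae_of_all _ fun x s _ => by
        have h1 : HasDerivAt (fun s : ℝ => s * inner ℝ w x + α) (inner ℝ w x) s := by
          simpa using ((hasDerivAt_id s).mul_const (inner ℝ w x)).add_const α
        exact h1.cos.const_mul (F x))).2
  -- The hypothesis at the frequency `t • w`; the divergence term gives `t c'(t)` plus the variance
  -- term.
  have hode : ∀ t, c t + t * d t + t ^ 2 * σ * c t = 0 := fun t => by
    have h1 := h (t • w) α
    rw [inner_cosLp, inner_divCosLp] at h1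
    simp only [real_inner_smul_left, map_smul, real_inner_smul_right, ← add_assoc,
      Real.cos_add_pi_div_two, Real.sin_add_pi_div_two] at h1
    have h2 : ∀ x, F x * (-Real.sin (t * inner ℝ w x + α) * (t * inner ℝ w x)
        + Real.cos (t * inner ℝ w x + α) * (t * (t * σ)))
        = t * (F x * (-Real.sin (t * inner ℝ w x + α) * inner ℝ w x))
          + (t ^ 2 * σ) * (F x * Real.cos (t * inner ℝ w x + α)) := fun x => by ring
    simp_rw [← hσ, h2] at h1
    rw [integral_add ((hFd t).const_mul t) ((hFc t).const_mul _), integral_const_mul,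
      integral_const_mul, ← add_assoc] at h1
    exact h1
  -- `exp(t² σ / 2)` is an integrating factor for the equation `(t c)' + t² σ c = 0`.
  have hconst : ∀ t, HasDerivAt (fun t => t * Real.exp (t ^ 2 * σ / 2) * c t) 0 t := fun t => by
    have h1 : HasDerivAt (fun t : ℝ => t ^ 2 * σ / 2) (t * σ) t := by
      have := ((hasDerivAt_pow 2 t).mul_const σ).div_const 2
      convert! this using 1
      simp
      ring
    have h2 := ((hasDerivAt_id t).mul h1.exp).mul (hderiv t)
    convert! h2 using 1
    simp only [id, Pi.mul_apply]
    linear_combination (-Real.exp (t ^ 2 * σ / 2)) * hode t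
  -- The factor `t` makes the constant vanish at `t = 0`, hence `c 1 = 0`.
  have h01 := is_const_of_deriv_eq_zero (fun t => (hconst t).differentiableAt)
    (fun t => (hconst t).deriv) 1 0
  simp only [one_mul, zero_mul] at h01
  have h2 := (mul_eq_zero.1 h01).resolve_left (Real.exp_ne_zero _)
  simpa [hc] using h2

/-- Membership in `weakGraph` trades the field term for a divergence acting on `u.1`, so the
orthogonality becomes a condition on `u.1` alone. -/
theorem eq_zero_of_orthogonal_cos (hnd : LinearMap.ker (covarianceOperator γ).toLinearMap = ⊥)
    {u : Lp ℝ 2 γ × Lp X 2 γ} (hu : u ∈ weakGraph γ)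
    (h : ∀ (w : X) (α : ℝ), inner ℝ (cosLp γ w α) u.1
      + inner ℝ (cosFieldLp γ w w (α + Real.pi / 2)) u.2 = 0) : u = 0 := by
  have h1 : u.1 = 0 := by
    rw [Lp.eq_zero_iff_ae_eq_zero]
    refine ae_eq_zero_of_integral_cos ((Lp.memLp u.1).integrable one_le_two)
      (integral_mul_cos_eq_zero fun w α => ?_)
    rw [← hu]
    exact h w α
  have h2 : u.2 = 0 := snd_eq_zero_of_mem_weakGraph hnd (by rw [← h1]; exact hu)
  exact Prod.ext h1 h2

/-- A space of weakly differentiable functions whose closure contains the trigonometric functions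
is dense in the space of all weakly differentiable functions. -/
theorem topologicalClosure_eq_weakGraph
    (hnd : LinearMap.ker (covarianceOperator γ).toLinearMap = ⊥)
    {A : Submodule ℝ (Lp ℝ 2 γ × Lp X 2 γ)} (hA : A ≤ weakGraph γ)
    (hcos : ∀ (w : X) (α : ℝ),
      (cosLp γ w α, cosFieldLp γ w w (α + Real.pi / 2)) ∈ A.topologicalClosure) :
    A.topologicalClosure = weakGraph γ := by
  refine le_antisymm (Submodule.topologicalClosure_minimal _ hA isClosed_weakGraph) fun u hu => ?_
  -- The `ℓ²` product is a Hilbert space carrying the graph inner product, so orthogonal projection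
  -- onto the closure is available.
  let e := WithLp.prodContinuousLinearEquiv 2 ℝ (Lp ℝ 2 γ) (Lp X 2 γ)
  let K : Submodule ℝ (WithLp 2 (Lp ℝ 2 γ × Lp X 2 γ)) :=
    A.topologicalClosure.comap e.toLinearEquiv.toLinearMap
  have hK : IsClosed (K : Set (WithLp 2 (Lp ℝ 2 γ × Lp X 2 γ))) :=
    (A.isClosed_topologicalClosure).preimage e.continuous
  have : CompleteSpace K := hK.completeSpace_coe
  obtain ⟨a, ha, b, hb, hab⟩ := K.exists_add_mem_mem_orthogonal (e.symm u)
  have hu' : u = e a + e b := by rw [← map_add, ← hab, e.apply_symm_apply]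
  have ha' : e a ∈ A.topologicalClosure := ha
  have hb' : e b ∈ weakGraph γ := by
    have h1 : e b = u - e a := by rw [hu']; abel
    rw [h1]
    exact sub_mem hu (Submodule.topologicalClosure_minimal _ hA isClosed_weakGraph ha')
  have hb0 : e b = 0 := eq_zero_of_orthogonal_cos hnd hb' fun w α => by
    have h2 : e.symm (cosLp γ w α, cosFieldLp γ w w (α + Real.pi / 2)) ∈ K := by
      change e (e.symm _) ∈ A.topologicalClosure
      rw [e.apply_symm_apply]
      exact hcos w α
    exact (Submodule.mem_orthogonal _ _).1 hb _ h2
  rw [hu', hb0, add_zero]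
  exact ha'

theorem smoothGraph_le_weakGraph (hcent : ∀ f : StrongDual ℝ X, ∫ x, f x ∂γ = 0) :
    smoothGraph γ 2 (sqrtGradLin γ) ≤ weakGraph γ := by
  rintro u ⟨f, hf, hf'⟩ y w α
  rw [inner_cosFieldLp, inner_divCosLp]
  refine Eq.trans (integral_congr_ae ?_)
    ((integral_mul_inner_sqrtGrad hcent f.2 (cos_inner_mem_Cb1 w α) y).trans
      (integral_congr_ae ?_))
  · filter_upwards [hf'] with x hx
    rw [hx]
    rfl
  · filter_upwards [hf] with x hx
    rw [hx, (hasFDerivAt_cos_inner w α x).fderiv, smul_apply, innerSL_apply_apply,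
      ← covSqrt_covSqrt, ← covSqrt_inner, smul_eq_mul]
    ring

/-- Writing `-sin` as a cosine with phase shifted by `π/2` makes the gradient one of the
trigonometric test fields. -/
theorem sqrtGrad_cos (w : X) (α : ℝ) (x : X) :
    covSqrt γ (∇ (fun x => Real.cos (inner ℝ w x + α)) x)
      = Real.cos (inner ℝ w x + (α + Real.pi / 2)) • covSqrt γ w := by
  have h : ∇ (fun x => Real.cos (inner ℝ w x + α)) x = -Real.sin (inner ℝ w x + α) • w := by
    rw [gradient, (hasFDerivAt_cos_inner w α x).fderiv, map_smul]
    congr 1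
    exact (InnerProductSpace.toDual ℝ X).symm_apply_apply w
  rw [h, map_smul, ← add_assoc, Real.cos_add_pi_div_two]

theorem cosLp_mem_smoothGraph (w : X) (α : ℝ) :
    (cosLp γ w α, cosFieldLp γ w w (α + Real.pi / 2)) ∈ smoothGraph γ 2 (sqrtGradLin γ) := by
  refine ⟨⟨_, cos_inner_mem_Cb1 w α⟩, (memLp_cos_inner γ w α).coeFn_toLp,
    (memLp_cos_smul γ w w (α + Real.pi / 2)).coeFn_toLp.trans (ae_of_all _ fun x => ?_)⟩
  exact (sqrtGrad_cos w α x).symm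

theorem topologicalClosure_smoothGraph (hcent : ∀ f : StrongDual ℝ X, ∫ x, f x ∂γ = 0)
    (hnd : LinearMap.ker (covarianceOperator γ).toLinearMap = ⊥) :
    (smoothGraph γ 2 (sqrtGradLin γ)).topologicalClosure = weakGraph γ :=
  topologicalClosure_eq_weakGraph hnd (smoothGraph_le_weakGraph hcent) fun w α =>
    Submodule.le_topologicalClosure _ (cosLp_mem_smoothGraph w α)

end WeakDerivative

/-! ### Dominated convergence in `L²`. -/

section DominatedConvergence

open Filter Topology

theorem tendsto_toLp_of_dominated {Ω : Type*} [MeasurableSpace Ω] {P : Measure Ω} {E : Type*}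
    [NormedAddCommGroup E] [InnerProductSpace ℝ E] {f : ℕ → Ω → E} {f₀ : Ω → E} {g : Ω → ℝ}
    (hf : ∀ n, MemLp (f n) 2 P) (hf₀ : MemLp f₀ 2 P) (hg : MemLp g 2 P)
    (hfg : ∀ n, ∀ᵐ x ∂P, ‖f n x‖ ≤ g x) (hf₀g : ∀ᵐ x ∂P, ‖f₀ x‖ ≤ g x)
    (hlim : ∀ᵐ x ∂P, Tendsto (fun n => f n x) atTop (𝓝 (f₀ x))) :
    Tendsto (fun n => (hf n).toLp (f n)) atTop (𝓝 (hf₀.toLp f₀)) := by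
  have hn : ∀ n, ‖(hf n).toLp (f n) - hf₀.toLp f₀‖ ^ 2 = ∫ x, ‖f n x - f₀ x‖ ^ 2 ∂P := fun n => by
    rw [← MemLp.toLp_sub, ← real_inner_self_eq_norm_sq, L2.inner_def]
    refine integral_congr_ae ?_
    filter_upwards [((hf n).sub hf₀).coeFn_toLp] with x hx
    rw [hx, real_inner_self_eq_norm_sq, Pi.sub_apply]
  have h0 : Tendsto (fun n => ∫ x, ‖f n x - f₀ x‖ ^ 2 ∂P) atTop (𝓝 (∫ _, (0 : ℝ) ∂P)) := by
    refine tendsto_integral_of_dominated_convergence (fun x => 4 * g x ^ 2)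
      (fun n => (((hf n).sub hf₀).1.norm.pow 2)) (hg.integrable_sq.const_mul 4) (fun n => ?_) ?_
    · filter_upwards [hfg n, hf₀g] with x h1 h2
      rw [norm_pow, norm_norm]
      have h3 : ‖f n x - f₀ x‖ ≤ 2 * g x := (norm_sub_le _ _).trans (by linarith)
      calc ‖f n x - f₀ x‖ ^ 2 ≤ (2 * g x) ^ 2 := by gcongr
        _ = _ := by ring
    · filter_upwards [hlim] with x hx
      have := ((hx.sub_const (f₀ x)).norm).pow 2
      simpa using this
  rw [integral_zero] at h0
  simp_rw [← hn] at h0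
  rw [tendsto_iff_norm_sub_tendsto_zero]
  have h1 := h0.sqrt
  simpa [Real.sqrt_sq (norm_nonneg _)] using h1

end DominatedConvergence

/-! ### Taylor polynomials of the cosine. -/

section TaylorCosine

open Filter Topology Nat

/-- Real part of `e^{iα}` times the series of `e^{iu}`, with `i^k = e^{ikπ/2}`. -/
theorem hasSum_cos_add (α u : ℝ) :
    HasSum (fun k : ℕ => Real.cos (α + k * (Real.pi / 2)) * (u ^ k / k !)) (Real.cos (u + α)) := by
  have h := (NormedSpace.expSeries_div_hasSum_exp ((u : ℂ) * Complex.I)).mul_left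
    (Complex.exp (α * Complex.I))
  rw [← Complex.exp_eq_exp_ℂ, ← Complex.exp_add] at h
  have h2 := Complex.hasSum_re h
  have e1 : (Complex.exp ((α : ℂ) * Complex.I + u * Complex.I)).re = Real.cos (u + α) := by
    rw [← add_mul, ← Complex.ofReal_add, Complex.exp_ofReal_mul_I_re, add_comm]
  rw [e1] at h2
  refine h2.congr_fun fun k => ?_
  have e2 : Complex.I ^ k = Complex.exp ((k * (Real.pi / 2) : ℝ) * Complex.I) := by
    conv_lhs => rw [← Complex.exp_pi_div_two_mul_I, ← Complex.exp_nat_mul]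
    push_cast
    rw [mul_assoc]
  have e3 : Complex.exp (α * Complex.I) * (((u : ℂ) * Complex.I) ^ k / (k ! : ℂ))
      = Complex.exp ((α + k * (Real.pi / 2) : ℝ) * Complex.I) * ((u ^ k / k ! : ℝ) : ℂ) := by
    rw [mul_pow, e2, Complex.ofReal_add, add_mul, Complex.exp_add]
    push_cast
    ring
  rw [e3, Complex.re_mul_ofReal, Complex.exp_ofReal_mul_I_re]

/-- The Taylor polynomials of `u ↦ cos (u + α)`. -/
noncomputable def cosTaylor (α : ℝ) (n : ℕ) (u : ℝ) : ℝ :=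
  ∑ k ∈ Finset.range n, Real.cos (α + k * (Real.pi / 2)) * (u ^ k / k !)

theorem tendsto_cosTaylor (α u : ℝ) :
    Tendsto (fun n => cosTaylor α n u) atTop (𝓝 (Real.cos (u + α))) :=
  (hasSum_cos_add α u).tendsto_sum_nat

theorem continuous_cosTaylor (α : ℝ) (n : ℕ) : Continuous (cosTaylor α n) := by
  unfold cosTaylor
  fun_prop

theorem abs_cosTaylor_le (α : ℝ) (n : ℕ) (u : ℝ) : |cosTaylor α n u| ≤ Real.exp |u| := by
  refine (Finset.abs_sum_le_sum_abs _ _).trans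
    (le_trans (Finset.sum_le_sum fun k _ => ?_) (Real.sum_le_exp_of_nonneg (abs_nonneg u) n))
  rw [abs_mul, abs_div, abs_pow, Nat.abs_cast]
  exact mul_le_of_le_one_left (by positivity) (Real.abs_cos_le_one _)

/-- The Taylor polynomials of `u ↦ cos (u + α)` as formal polynomials. -/
noncomputable def cosTaylorPoly (α : ℝ) (n : ℕ) : MvPolynomial (Fin 1) ℝ :=
  ∑ k ∈ Finset.range n,
    MvPolynomial.C (Real.cos (α + k * (Real.pi / 2)) / k !) * MvPolynomial.X 0 ^ k

theorem eval_cosTaylorPoly (α : ℝ) (n : ℕ) (v : Fin 1 → ℝ) :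
    MvPolynomial.eval v (cosTaylorPoly α n) = cosTaylor α n (v 0) := by
  simp only [cosTaylorPoly, cosTaylor, map_sum, map_mul, map_pow, MvPolynomial.eval_C,
    MvPolynomial.eval_X]
  exact Finset.sum_congr rfl fun k _ => by ring

/-- Differentiation lowers the degree by one and shifts the phase by `π/2`, whence `n + 1` terms on
the left and `n` on the right. -/
theorem eval_pderiv_cosTaylorPoly (α : ℝ) (n : ℕ) (v : Fin 1 → ℝ) :
    MvPolynomial.eval v (MvPolynomial.pderiv 0 (cosTaylorPoly α (n + 1)))
      = cosTaylor (α + Real.pi / 2) n (v 0) := by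
  simp only [cosTaylorPoly, cosTaylor, map_sum]
  rw [Finset.sum_range_succ']
  simp only [Derivation.leibniz, Derivation.leibniz_pow, MvPolynomial.pderiv_C,
    MvPolynomial.pderiv_X_self, smul_eq_mul, nsmul_eq_mul, map_mul, map_pow, map_natCast,
    MvPolynomial.eval_C, MvPolynomial.eval_X, pow_zero, mul_one, mul_zero, add_zero, map_zero,
    Nat.cast_zero, zero_mul]
  refine Finset.sum_congr rfl fun k _ => ?_
  have h : ((k + 1 : ℕ) : ℝ) ≠ 0 := by positivity
  rw [Nat.factorial_succ, Nat.add_sub_cancel, Nat.cast_mul]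
  have h2 : α + ((k + 1 : ℕ) : ℝ) * (Real.pi / 2) = α + Real.pi / 2 + k * (Real.pi / 2) := by
    push_cast; ring
  rw [h2]
  field_simp

end TaylorCosine

/-! ### Polynomials as a core of the weak derivative. -/

section PolynomialCore

open Filter Topology

variable {X : Type u} [NormedAddCommGroup X] [InnerProductSpace ℝ X] [CompleteSpace X]
  [SecondCountableTopology X] [MeasurableSpace X] [BorelSpace X] {γ : Measure X} [IsGaussian γ]

theorem memLp_exp_abs_inner (w : X) : MemLp (fun x : X => Real.exp |inner ℝ w x|) 2 γ := by
  rw [memLp_two_iff_integrable_sq (by fun_prop)]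
  have h : ∀ t : ℝ, Integrable (fun x : X => Real.exp (t * inner ℝ w x)) γ := fun t => by
    have h1 := IsGaussian.map_eq_gaussianReal (μ := γ) (innerSL ℝ w)
    have h2 := integrable_exp_mul_gaussianReal (μ := γ[innerSL ℝ w])
      (v := Var[innerSL ℝ w; γ].toNNReal) t
    rw [← h1, integrable_map_measure (by fun_prop) (by fun_prop)] at h2
    exact h2
  have h3 := integrable_exp_mul_abs (X := fun x : X => inner ℝ w x) (t := 2) (h 2) (h (-2))
  refine h3.congr (ae_of_all _ fun x => ?_)
  change _ = Real.exp |inner ℝ w x| ^ 2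
  rw [← Real.exp_nat_mul]
  norm_num

theorem memLp_polyVar {𝓗 : Type v} [NormedAddCommGroup 𝓗] [InnerProductSpace ℝ 𝓗]
    (W : 𝓗 ≃ₗᵢ[ℝ] gaussHilbert γ) {m : ℕ} (q : MvPolynomial (Fin m) ℝ) (h : Fin m → 𝓗) :
    MemLp (polyVar W q h) 2 γ :=
  memLp_poly_gaussVec (fun i => W (h i)) q

theorem memLp_polyDeriv {𝓗 : Type v} [NormedAddCommGroup 𝓗] [InnerProductSpace ℝ 𝓗]
    (W : 𝓗 ≃ₗᵢ[ℝ] gaussHilbert γ) {m : ℕ} (q : MvPolynomial (Fin m) ℝ) (h : Fin m → 𝓗) :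
    MemLp (polyDeriv W q h) 2 γ := by
  refine memLp_finsetSum _ fun i _ => ?_
  have h1 := memLp_polyVar W (MvPolynomial.pderiv i q) h
  refine (h1.norm.mul_const ‖h i‖).mono' (h1.1.smul_const _) (ae_of_all _ fun x => ?_)
  rw [norm_smul]

theorem integral_polyVar_cos (hcent : ∀ f : StrongDual ℝ X, ∫ x, f x ∂γ = 0)
    (hnd : LinearMap.ker (covarianceOperator γ).toLinearMap = ⊥) {m : ℕ}
    (q : MvPolynomial (Fin m) ℝ) (h : Fin m → X) (y w : X) (α : ℝ) :
    ∫ x, Real.cos (inner ℝ w x + α) * inner ℝ (covSqrt γ y)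
        (polyDeriv (whiteNoiseIso hcent hnd) q h x) ∂γ
      = ∫ x, polyVar (whiteNoiseIso hcent hnd) q h x * (Real.cos (inner ℝ w x + α) * inner ℝ y x
        + Real.sin (inner ℝ w x + α) * inner ℝ (covSqrt γ w) (covSqrt γ y)) ∂γ := by
  set W := whiteNoiseIso hcent hnd with hW
  -- Two extra coordinates, on which `q` does not depend: their white noises are `⟨y, ·⟩`, the
  -- direction, and `⟨w, ·⟩`, the argument of the cosine.
  let z : Fin m ⊕ Bool → X := Sum.elim h (fun b => bif b then covSqrt γ y else covSqrt γ w)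
  have hz : ∀ i j, inner ℝ (W (z i)) (W (z j)) = inner ℝ (z i) (z j) := fun i j =>
    LinearIsometryEquiv.inner_map_map W _ _
  have hmain := integral_poly_cos_gaussVec (fun i => W (z i)) (MvPolynomial.rename Sum.inl q)
    (Sum.inr false) (Sum.inr true) α
  have hy : (W (covSqrt γ y) : Lp ℝ 2 γ) =ᵐ[γ] fun x => inner ℝ y x :=
    whiteNoise_covSqrt_ae hcent hnd y
  have hw : (W (covSqrt γ w) : Lp ℝ 2 γ) =ᵐ[γ] fun x => inner ℝ w x :=
    whiteNoise_covSqrt_ae hcent hnd w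
  have hev : ∀ (r : MvPolynomial (Fin m) ℝ) (x : X), MvPolynomial.eval
      (gaussVec (fun i => W (z i)) x) (MvPolynomial.rename Sum.inl r) = polyVar W r h x :=
    fun r x => by rw [MvPolynomial.eval_rename]; rfl
  have hinr : ∀ b : Bool, MvPolynomial.pderiv (Sum.inr b) (MvPolynomial.rename Sum.inl q)
      = (0 : MvPolynomial (Fin m ⊕ Bool) ℝ) := fun b => by
    classical
    refine MvPolynomial.pderiv_eq_zero_of_notMem_vars fun hi => ?_
    obtain ⟨j, -, hj⟩ := Finset.mem_image.1 (MvPolynomial.vars_rename _ _ hi)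
    simp at hj
  have hsum : ∀ x, ∑ i, MvPolynomial.eval (gaussVec (fun i => W (z i)) x)
      (MvPolynomial.pderiv i (MvPolynomial.rename Sum.inl q)) *
        inner ℝ (z i) (z (Sum.inr true))
      = inner ℝ (covSqrt γ y) (polyDeriv W q h x) := fun x => by
    rw [Fintype.sum_sum_type]
    simp only [hinr, map_zero, zero_mul, Finset.sum_const_zero, add_zero]
    rw [polyDeriv, inner_sum]
    refine Finset.sum_congr rfl fun i _ => ?_
    rw [MvPolynomial.pderiv_rename Sum.inl_injective, hev, inner_smul_right,
      real_inner_comm (h i) (covSqrt γ y)]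
    rfl
  simp only [hz, hsum, hev] at hmain
  have hq := memLp_polyVar W q h
  have hD := memLp_polyDeriv W q h
  have i1 : Integrable (fun x => Real.cos (inner ℝ w x + α) *
      inner ℝ (covSqrt γ y) (polyDeriv W q h x)) γ := by
    refine Integrable.bdd_mul (c := 1)
      ((innerSL ℝ (covSqrt γ y)).integrable_comp (hD.integrable one_le_two)) (by fun_prop)
      (ae_of_all _ fun x => Real.abs_cos_le_one _)
  have i2 : Integrable (fun x => polyVar W q h x * (Real.sin (inner ℝ w x + α) *
      inner ℝ (covSqrt γ w) (covSqrt γ y))) γ := by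
    refine (hq.integrable one_le_two).mul_bdd (c := ‖inner ℝ (covSqrt γ w) (covSqrt γ y)‖)
      (by fun_prop) (ae_of_all _ fun x => ?_)
    rw [norm_mul]
    exact mul_le_of_le_one_left (norm_nonneg _) (Real.abs_sin_le_one _)
  have i3 : Integrable (fun x => polyVar W q h x * (Real.cos (inner ℝ w x + α) * inner ℝ y x)) γ :=
    hq.integrable_mul ((memLp_inner_left γ y).mono (by fun_prop) (ae_of_all _ fun x => by
      rw [norm_mul]
      exact mul_le_of_le_one_left (norm_nonneg _) (Real.abs_cos_le_one _)))
  have e1 : ∫ x, (Real.cos (inner ℝ w x + α) * inner ℝ (covSqrt γ y) (polyDeriv W q h x)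
      - polyVar W q h x * (Real.sin (inner ℝ w x + α) * inner ℝ (covSqrt γ w) (covSqrt γ y))) ∂γ
      = ∫ x, polyVar W q h x * (Real.cos (inner ℝ w x + α) * inner ℝ y x) ∂γ := by
    refine Eq.trans (integral_congr_ae ?_) (hmain.trans (integral_congr_ae ?_))
    · filter_upwards [hw] with x hx
      rw [show gaussVec (fun i => W (z i)) x (Sum.inr false) = inner ℝ w x from hx, mul_comm]
      rfl
    · filter_upwards [hw, hy] with x hx hx'
      rw [show gaussVec (fun i => W (z i)) x (Sum.inr false) = inner ℝ w x from hx,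
        show gaussVec (fun i => W (z i)) x (Sum.inr true) = inner ℝ y x from hx', mul_assoc]
  rw [integral_sub i1 i2] at e1
  rw [eq_add_of_sub_eq e1, ← integral_add i3 i2]
  exact integral_congr_ae (ae_of_all _ fun x => by ring)

theorem polyGraph_le_weakGraph (hcent : ∀ f : StrongDual ℝ X, ∫ x, f x ∂γ = 0)
    (hnd : LinearMap.ker (covarianceOperator γ).toLinearMap = ⊥) :
    polyGraph 2 (whiteNoiseIso hcent hnd) ≤ weakGraph γ := by
  rintro u ⟨m, q, h, hq, hq'⟩ y w α
  rw [inner_cosFieldLp, inner_divCosLp]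
  refine Eq.trans (integral_congr_ae ?_)
    ((integral_polyVar_cos hcent hnd q h y w α).trans (integral_congr_ae ?_))
  · filter_upwards [hq'] with x hx
    rw [hx]
  · filter_upwards [hq] with x hx
    rw [hx]

/-- Taylor polynomials in `⟨w, ·⟩` and their derivatives converge in `L²`, dominated by multiples of
`exp |⟨w, ·⟩|`, which is square integrable by Gaussianity. -/
theorem cosLp_mem_closure_polyGraph (hcent : ∀ f : StrongDual ℝ X, ∫ x, f x ∂γ = 0)
    (hnd : LinearMap.ker (covarianceOperator γ).toLinearMap = ⊥) (w : X) (α : ℝ) :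
    (cosLp γ w α, cosFieldLp γ w w (α + Real.pi / 2))
      ∈ (polyGraph 2 (whiteNoiseIso hcent hnd)).topologicalClosure := by
  have hg := memLp_exp_abs_inner (γ := γ) w
  have hT : ∀ β n, MemLp (fun x => cosTaylor β n (inner ℝ w x)) 2 γ := fun β n =>
    hg.mono' ((continuous_cosTaylor β n).comp (by fun_prop)).aestronglyMeasurable
      (ae_of_all _ fun x => abs_cosTaylor_le _ _ _)
  have hle : ∀ u : ℝ, |Real.cos u| ≤ 1 := Real.abs_cos_le_one
  have hexp : ∀ x : X, 1 ≤ Real.exp |inner ℝ w x| := fun x => Real.one_le_exp (abs_nonneg _)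
  have hf' : ∀ n, MemLp (fun x => cosTaylor (α + Real.pi / 2) n (inner ℝ w x) • covSqrt γ w) 2 γ :=
    fun n => ((hT (α + Real.pi / 2) n).norm.mul_const ‖covSqrt γ w‖).mono'
      ((hT _ n).1.smul_const _) (ae_of_all _ fun x => (norm_smul _ _).le)
  have h1 : Tendsto (fun n => (hT α (n + 1)).toLp _) atTop (𝓝 (cosLp γ w α)) :=
    tendsto_toLp_of_dominated (fun n => hT α (n + 1)) (memLp_cos_inner γ w α) hg
      (fun n => ae_of_all _ fun x => abs_cosTaylor_le _ _ _)
      (ae_of_all _ fun x => (hle _).trans (hexp x))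
      (ae_of_all _ fun x => (tendsto_cosTaylor α _).comp (tendsto_add_atTop_nat 1))
  have h2 : Tendsto (fun n => (hf' n).toLp _) atTop
      (𝓝 (cosFieldLp γ w w (α + Real.pi / 2))) :=
    tendsto_toLp_of_dominated hf' (memLp_cos_smul γ w w (α + Real.pi / 2))
      (hg.mul_const ‖covSqrt γ w‖)
      (fun n => ae_of_all _ fun x => by
        rw [norm_smul]
        gcongr
        exact abs_cosTaylor_le _ _ _)
      (ae_of_all _ fun x => by
        rw [norm_smul]
        gcongr
        exact (hle _).trans (hexp x))
      (ae_of_all _ fun x => (tendsto_cosTaylor _ _).smul_const _)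
  refine mem_closure_of_tendsto (h1.prodMk_nhds h2) (Eventually.of_forall fun n => ?_)
  have hw : (whiteNoise γ (covSqrt γ w) : Lp ℝ 2 γ) =ᵐ[γ] fun x => inner ℝ w x :=
    whiteNoise_covSqrt_ae hcent hnd w
  refine ⟨1, cosTaylorPoly α (n + 1), fun _ => covSqrt γ w, ?_, ?_⟩
  · filter_upwards [(hT α (n + 1)).coeFn_toLp, hw] with x hx hx'
    rw [hx, polyVar, eval_cosTaylorPoly, ← hx']
    rfl
  · filter_upwards [(hf' n).coeFn_toLp, hw] with x hx hx'
    rw [hx, polyDeriv, Fin.sum_univ_one, polyVar, eval_pderiv_cosTaylorPoly, ← hx']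
    rfl

theorem topologicalClosure_polyGraph (hcent : ∀ f : StrongDual ℝ X, ∫ x, f x ∂γ = 0)
    (hnd : LinearMap.ker (covarianceOperator γ).toLinearMap = ⊥) :
    (polyGraph 2 (whiteNoiseIso hcent hnd)).topologicalClosure = weakGraph γ :=
  topologicalClosure_eq_weakGraph hnd (polyGraph_le_weakGraph hcent hnd)
    (cosLp_mem_closure_polyGraph hcent hnd)

end PolynomialCore

/-! ### Closable operators given by their graphs. -/

section ClosureOfGraph

variable {E F : Type*} [NormedAddCommGroup E] [NormedSpace ℝ E] [NormedAddCommGroup F]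
  [NormedSpace ℝ F] {g : Submodule ℝ (E × F)}

/-- The condition `hg`, that the closure contains no nonzero vertical vector, yields both that the
operator is well defined on `g` and that it is closable. -/
theorem snd_eq_zero_of_closure (hg : ∀ v, ((0 : E), v) ∈ g.topologicalClosure → v = 0)
    (x : E × F) (hx : x ∈ g.topologicalClosure) (h0 : x.1 = 0) : x.2 = 0 :=
  hg x.2 (by rw [← h0]; exact hx)

theorem graph_toLinearPMap_of_closure (hg : ∀ v, ((0 : E), v) ∈ g.topologicalClosure → v = 0) :
    g.toLinearPMap.graph = g :=
  Submodule.toLinearPMap_graph_eq _ fun x hx h0 =>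
    snd_eq_zero_of_closure hg x (Submodule.le_topologicalClosure _ hx) h0

theorem isClosable_toLinearPMap (hg : ∀ v, ((0 : E), v) ∈ g.topologicalClosure → v = 0) :
    g.toLinearPMap.IsClosable :=
  ⟨g.topologicalClosure.toLinearPMap, by
    rw [graph_toLinearPMap_of_closure hg,
      Submodule.toLinearPMap_graph_eq _ (snd_eq_zero_of_closure hg)]⟩

theorem graph_closure_toLinearPMap (hg : ∀ v, ((0 : E), v) ∈ g.topologicalClosure → v = 0) :
    g.toLinearPMap.closure.graph = g.topologicalClosure := by
  rw [← (isClosable_toLinearPMap hg).graph_closure_eq_closure_graph,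
    graph_toLinearPMap_of_closure hg]

theorem exists_domain_toLinearPMap (hg : ∀ v, ((0 : E), v) ∈ g.topologicalClosure → v = 0)
    {u : E × F} (hu : u ∈ g) :
    ∃ x : g.toLinearPMap.domain, (x : E) = u.1 ∧ g.toLinearPMap x = u.2 := by
  rw [← graph_toLinearPMap_of_closure hg] at hu
  exact (LinearPMap.mem_graph_iff _).1 hu

theorem mem_domain_closure (hg : ∀ v, ((0 : E), v) ∈ g.topologicalClosure → v = 0) {x : E} :
    x ∈ g.toLinearPMap.closure.domain ↔ ∃ y, (x, y) ∈ g.topologicalClosure := by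
  rw [LinearPMap.mem_domain_iff, graph_closure_toLinearPMap hg]

theorem closure_apply_eq_iff (hg : ∀ v, ((0 : E), v) ∈ g.topologicalClosure → v = 0) {x : E} {y : F}
    (hx : x ∈ g.toLinearPMap.closure.domain) :
    g.toLinearPMap.closure ⟨x, hx⟩ = y ↔ (x, y) ∈ g.topologicalClosure := by
  rw [eq_comm, LinearPMap.image_iff hx, graph_closure_toLinearPMap hg]

end ClosureOfGraph

/-! ### Transfer of graphs by a unitary operator on the values. -/

section Transfer

variable {Ω : Type*} [MeasurableSpace Ω] {P : Measure Ω} {E₁ E₂ : Type*} [NormedAddCommGroup E₁]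
  [InnerProductSpace ℝ E₁] [NormedAddCommGroup E₂] [InnerProductSpace ℝ E₂] (p : ℝ≥0∞)

/-- Pointwise application of a unitary operator to an `L^p` function. -/
noncomputable def isoLp [Fact (1 ≤ p)] (P : Measure Ω) (V : E₁ ≃ₗᵢ[ℝ] E₂) :
    Lp E₁ p P →L[ℝ] Lp E₂ p P :=
  ContinuousLinearMap.compLpL p P (V : E₁ →L[ℝ] E₂)

variable {p} [Fact (1 ≤ p)]

theorem coeFn_isoLp (V : E₁ ≃ₗᵢ[ℝ] E₂) (G : Lp E₁ p P) :
    isoLp p P V G =ᵐ[P] fun x => V (G x) :=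
  ContinuousLinearMap.coeFn_compLpL _ G

theorem norm_isoLp (V : E₁ ≃ₗᵢ[ℝ] E₂) (G : Lp E₁ p P) : ‖isoLp p P V G‖ = ‖G‖ := by
  rw [Lp.norm_def, Lp.norm_def]
  congr 1
  refine eLpNorm_congr_norm_ae ?_
  filter_upwards [coeFn_isoLp V G] with x hx
  rw [hx, LinearIsometryEquiv.norm_map]

theorem isoLp_symm_isoLp (V : E₁ ≃ₗᵢ[ℝ] E₂) (G : Lp E₁ p P) :
    isoLp p P V.symm (isoLp p P V G) = G := by
  refine Lp.ext ?_
  filter_upwards [coeFn_isoLp V.symm (isoLp p P V G), coeFn_isoLp V G] with x h1 h2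
  rw [h1, h2, LinearIsometryEquiv.symm_apply_apply]

theorem isoLp_mem_closure {V : E₁ ≃ₗᵢ[ℝ] E₂} {A : Submodule ℝ (Lp ℝ p P × Lp E₁ p P)}
    {B : Submodule ℝ (Lp ℝ p P × Lp E₂ p P)}
    (h : ∀ u ∈ A, (u.1, isoLp p P V u.2) ∈ B) {u : Lp ℝ p P × Lp E₁ p P}
    (hu : u ∈ A.topologicalClosure) : (u.1, isoLp p P V u.2) ∈ B.topologicalClosure :=
  map_mem_closure (f := fun u : Lp ℝ p P × Lp E₁ p P => (u.1, isoLp p P V u.2))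
    (by fun_prop) hu h

/-- If a unitary operator maps the graph `A` into a closable graph, then `A` is closable. -/
theorem snd_eq_zero_of_isoLp {V : E₁ ≃ₗᵢ[ℝ] E₂} {A : Submodule ℝ (Lp ℝ p P × Lp E₁ p P)}
    {B : Submodule ℝ (Lp ℝ p P × Lp E₂ p P)}
    (h : ∀ u ∈ A, (u.1, isoLp p P V u.2) ∈ B)
    (hB : ∀ G, ((0 : Lp ℝ p P), G) ∈ B.topologicalClosure → G = 0) {G : Lp E₁ p P}
    (hG : ((0 : Lp ℝ p P), G) ∈ A.topologicalClosure) : G = 0 := by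
  rw [← isoLp_symm_isoLp V G, hB _ (isoLp_mem_closure h hG), map_zero]

end Transfer

/-! ### Comparison of the three derivatives. -/

section Comparison

variable {X : Type u} [NormedAddCommGroup X] [InnerProductSpace ℝ X] [CompleteSpace X]
  [SecondCountableTopology X] [MeasurableSpace X] [BorelSpace X] {γ : Measure X} [IsGaussian γ]

theorem isoLp_const {E₁ E₂ : Type*} [NormedAddCommGroup E₁] [InnerProductSpace ℝ E₁]
    [NormedAddCommGroup E₂] [InnerProductSpace ℝ E₂] (V : E₁ ≃ₗᵢ[ℝ] E₂) (z : E₁) :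
    isoLp 2 γ V (Lp.const 2 γ z) = Lp.const 2 γ (V z) := by
  refine Lp.ext ?_
  filter_upwards [coeFn_isoLp V (Lp.const 2 γ z), Lp.coeFn_const (p := 2) (μ := γ) z,
    Lp.coeFn_const (p := 2) (μ := γ) (V z)] with x h1 h2 h3
  rw [h1, h2, h3]
  rfl

/-- The covariance operator of a Gaussian measure on an infinite-dimensional space is not the
identity. -/
theorem exists_covarianceOperator_ne (hX : ¬ FiniteDimensional ℝ X) :
    ∃ w : X, covarianceOperator γ w ≠ w := by
  by_contra! hQ
  -- If `Q` were the identity, each of `n` orthonormal coordinates would have variance one, and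
  -- Bessel's inequality would give `n ≤ ∫ ‖x‖² dγ`.
  obtain ⟨n, hn⟩ := exists_nat_gt (∫ x, ‖x‖ ^ 2 ∂γ)
  have hr : (n : Cardinal) ≤ Module.rank ℝ X := by
    refine (Cardinal.natCast_le_aleph0 (n := n)).trans (not_lt.1 fun h => hX ?_)
    exact Module.rank_lt_aleph0_iff.1 h
  obtain ⟨v, hv⟩ := exists_linearIndependent_of_le_rank hr
  have he := InnerProductSpace.gramSchmidtNormed_orthonormal hv
  set e := InnerProductSpace.gramSchmidtNormed ℝ v
  have hm : ∀ i, Integrable (fun x => inner ℝ (e i) x * inner ℝ (e i) x) γ := fun i =>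
    (memLp_inner_left γ (e i)).integrable_mul (memLp_inner_left γ (e i))
  have h1 : ∫ x, ∑ i, inner ℝ (e i) x * inner ℝ (e i) x ∂γ = n := by
    rw [integral_finsetSum _ fun i _ => hm i]
    have h2 : ∀ i, ∫ x, inner ℝ (e i) x * inner ℝ (e i) x ∂γ = 1 := fun i => by
      rw [← covarianceOperator_inner IsGaussian.memLp_two_id, hQ, real_inner_self_eq_norm_sq,
        he.1 i, one_pow]
    simp [h2]
  have h2 : ∫ x, ∑ i, inner ℝ (e i) x * inner ℝ (e i) x ∂γ ≤ ∫ x, ‖x‖ ^ 2 ∂γ := by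
    refine integral_mono (integrable_finsetSum _ fun i _ => hm i)
      ((IsGaussian.memLp_two_id (μ := γ)).integrable_norm_pow two_ne_zero) fun x => ?_
    have := he.sum_inner_products_le x (s := Finset.univ)
    simpa [← sq] using this
  linarith

theorem exists_mem_smoothGraph_sqrtGrad (p : ℝ≥0∞) [Fact (1 ≤ p)] {φ : X → ℝ} (hφ : φ ∈ Cb1 X) :
    ∃ u ∈ smoothGraph γ p (sqrtGradLin γ),
      u.1 =ᵐ[γ] φ ∧ u.2 =ᵐ[γ] fun x => covSqrt γ (∇ φ x) := by
  obtain ⟨h1, ⟨A, hA⟩, ⟨B, hB⟩⟩ := id hφ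
  have hf : MemLp φ p γ :=
    MemLp.of_bound h1.continuous.aestronglyMeasurable A (ae_of_all _ hA)
  have hg : MemLp (fun x => covSqrt γ (∇ φ x)) p γ := by
    refine MemLp.of_bound ?_ (‖covSqrt γ‖ * B) (ae_of_all _ fun x => ?_)
    · exact ((covSqrt γ).continuous.comp ((InnerProductSpace.toDual ℝ X).symm.continuous.comp
        (h1.continuous_fderiv one_ne_zero))).aestronglyMeasurable
    · refine ((covSqrt γ).le_opNorm _).trans ?_
      gcongr
      rw [gradient, LinearIsometryEquiv.norm_map]
      exact hB x
  exact ⟨(hf.toLp _, hg.toLp _), ⟨⟨φ, hφ⟩, hf.coeFn_toLp, hg.coeFn_toLp⟩, hf.coeFn_toLp,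
    hg.coeFn_toLp⟩

variable (hcent : ∀ f : StrongDual ℝ X, ∫ x, f x ∂γ = 0)
  (hnd : LinearMap.ker (covarianceOperator γ).toLinearMap = ⊥)

theorem gradHLin_eq (f : Cb1 X) (x : X) :
    gradHLin γ f x = cameronMartinIso hcent hnd (sqrtGradLin γ f x) :=
  gradH_eq hcent hnd (f.2.1.differentiable one_ne_zero x)

theorem isoLp_mem_smoothGraph {p : ℝ≥0∞} [Fact (1 ≤ p)] (u : Lp ℝ p γ × Lp X p γ)
    (hu : u ∈ smoothGraph γ p (sqrtGradLin γ)) :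
    (u.1, isoLp p γ (cameronMartinIso hcent hnd) u.2) ∈ smoothGraph γ p (gradHLin γ) := by
  obtain ⟨f, hf, hf'⟩ := hu
  refine ⟨f, hf, ?_⟩
  filter_upwards [coeFn_isoLp (cameronMartinIso hcent hnd) u.2, hf'] with x hx hx'
  rw [gradHLin_eq hcent hnd, ← hx']
  exact hx

theorem isoLp_symm_mem_smoothGraph {p : ℝ≥0∞} [Fact (1 ≤ p)]
    (u : Lp ℝ p γ × Lp (CameronMartin γ) p γ) (hu : u ∈ smoothGraph γ p (gradHLin γ)) :
    (u.1, isoLp p γ (cameronMartinIso hcent hnd).symm u.2) ∈ smoothGraph γ p (sqrtGradLin γ) := by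
  obtain ⟨f, hf, hf'⟩ := hu
  refine ⟨f, hf, ?_⟩
  filter_upwards [coeFn_isoLp (cameronMartinIso hcent hnd).symm u.2, hf'] with x hx hx'
  rw [gradHLin_eq hcent hnd] at hx'
  rw [hx, hx', LinearIsometryEquiv.symm_apply_apply]

/-- Replacing `h_i` by `W₂⁻¹ W₁ h_i` leaves the random variables unchanged and only rotates the
values of the derivative. -/
theorem polyGraph_transfer {𝓗₁ 𝓗₂ : Type*} [NormedAddCommGroup 𝓗₁] [InnerProductSpace ℝ 𝓗₁]
    [NormedAddCommGroup 𝓗₂] [InnerProductSpace ℝ 𝓗₂] (W₁ : 𝓗₁ ≃ₗᵢ[ℝ] gaussHilbert γ)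
    (W₂ : 𝓗₂ ≃ₗᵢ[ℝ] gaussHilbert γ) (u : Lp ℝ 2 γ × Lp 𝓗₁ 2 γ) (hu : u ∈ polyGraph 2 W₁) :
    (u.1, isoLp 2 γ (W₁.trans W₂.symm) u.2) ∈ polyGraph 2 W₂ := by
  obtain ⟨m, q, h, hq, hq'⟩ := hu
  have hv : ∀ (r : MvPolynomial (Fin m) ℝ) (x : X),
      polyVar W₂ r (fun i => W₁.trans W₂.symm (h i)) x = polyVar W₁ r h x := fun r x => by
    simp only [polyVar, LinearIsometryEquiv.trans_apply, LinearIsometryEquiv.apply_symm_apply]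
  refine ⟨m, q, fun i => W₁.trans W₂.symm (h i), ?_, ?_⟩
  · filter_upwards [hq] with x hx
    rw [hx, hv]
  · filter_upwards [coeFn_isoLp (W₁.trans W₂.symm) u.2, hq'] with x hx hx'
    rw [hx, hx', polyDeriv, polyDeriv, map_sum]
    refine Finset.sum_congr rfl fun i _ => ?_
    rw [map_smul, hv]

include hcent hnd

theorem snd_eq_zero_of_mem_closure_gradH (p : ℝ≥0∞) [Fact (1 ≤ p)]
    (G : Lp (CameronMartin γ) p γ)
    (hG : ((0 : Lp ℝ p γ), G) ∈ (smoothGraph γ p (gradHLin γ)).topologicalClosure) : G = 0 :=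
  snd_eq_zero_of_isoLp (isoLp_symm_mem_smoothGraph hcent hnd)
    (fun _ h => snd_eq_zero_of_mem_closure_smoothGraph hcent hnd p h) hG

theorem mem_closure_polyGraph_transfer {𝓗 : Type v} [NormedAddCommGroup 𝓗] [InnerProductSpace ℝ 𝓗]
    (W : 𝓗 ≃ₗᵢ[ℝ] gaussHilbert γ) {u : Lp ℝ 2 γ × Lp 𝓗 2 γ}
    (hu : u ∈ (polyGraph 2 W).topologicalClosure) :
    (u.1, isoLp 2 γ (W.trans (whiteNoiseIso hcent hnd).symm) u.2)
      ∈ (smoothGraph γ 2 (sqrtGradLin γ)).topologicalClosure := by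
  rw [topologicalClosure_smoothGraph hcent hnd, ← topologicalClosure_polyGraph hcent hnd]
  exact isoLp_mem_closure (polyGraph_transfer W (whiteNoiseIso hcent hnd)) hu

theorem snd_eq_zero_of_mem_closure_polyGraph {𝓗 : Type v} [NormedAddCommGroup 𝓗]
    [InnerProductSpace ℝ 𝓗] (W : 𝓗 ≃ₗᵢ[ℝ] gaussHilbert γ) (G : Lp 𝓗 2 γ)
    (hG : ((0 : Lp ℝ 2 γ), G) ∈ (polyGraph 2 W).topologicalClosure) : G = 0 := by
  have h := snd_eq_zero_of_mem_closure_smoothGraph hcent hnd 2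
    (mem_closure_polyGraph_transfer hcent hnd W hG)
  rw [← isoLp_symm_isoLp (W.trans (whiteNoiseIso hcent hnd).symm) G, h, map_zero]

theorem W1p_eq_W1pSqrt (p : ℝ≥0∞) [Fact (1 ≤ p)] : W1p γ p = W1pSqrt γ p := by
  ext F
  have h1 : F ∈ W1p γ p ↔ ∃ G, (F, G) ∈ (smoothGraph γ p (gradHLin γ)).topologicalClosure :=
    mem_domain_closure (snd_eq_zero_of_mem_closure_gradH hcent hnd p)
  have h2 : F ∈ W1pSqrt γ p ↔
      ∃ G, (F, G) ∈ (smoothGraph γ p (sqrtGradLin γ)).topologicalClosure :=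
    mem_domain_closure fun _ h => snd_eq_zero_of_mem_closure_smoothGraph hcent hnd p h
  rw [h1, h2]
  constructor
  · rintro ⟨G, hG⟩
    exact ⟨_, isoLp_mem_closure (isoLp_symm_mem_smoothGraph hcent hnd) hG⟩
  · rintro ⟨G, hG⟩
    exact ⟨_, isoLp_mem_closure (isoLp_mem_smoothGraph hcent hnd) hG⟩

theorem D1p_eq_W1pSqrt {𝓗 : Type v} [NormedAddCommGroup 𝓗] [InnerProductSpace ℝ 𝓗]
    (W : 𝓗 ≃ₗᵢ[ℝ] gaussHilbert γ) : D1p 2 W = W1pSqrt γ 2 := by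
  ext F
  have h1 : F ∈ D1p 2 W ↔ ∃ G, (F, G) ∈ (polyGraph 2 W).topologicalClosure :=
    mem_domain_closure (snd_eq_zero_of_mem_closure_polyGraph hcent hnd W)
  have h2 : F ∈ W1pSqrt γ 2 ↔
      ∃ G, (F, G) ∈ (smoothGraph γ 2 (sqrtGradLin γ)).topologicalClosure :=
    mem_domain_closure fun _ h => snd_eq_zero_of_mem_closure_smoothGraph hcent hnd 2 h
  rw [h1, h2]
  constructor
  · rintro ⟨G, hG⟩
    exact ⟨_, mem_closure_polyGraph_transfer hcent hnd W hG⟩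
  · rintro ⟨G, hG⟩
    rw [topologicalClosure_smoothGraph hcent hnd, ← topologicalClosure_polyGraph hcent hnd] at hG
    exact ⟨_, isoLp_mem_closure (polyGraph_transfer (whiteNoiseIso hcent hnd) W) hG⟩

theorem mem_W1pSqrt_of_mem_closure {p : ℝ≥0∞} [Fact (1 ≤ p)] {F : Lp ℝ p γ} {G : Lp X p γ}
    (h : (F, G) ∈ (smoothGraph γ p (sqrtGradLin γ)).topologicalClosure) :
    ∃ hF : F ∈ W1pSqrt γ p, daPratoM γ p ⟨F, hF⟩ = G := by
  have hc := fun (G : Lp X p γ) h => snd_eq_zero_of_mem_closure_smoothGraph hcent hnd p (G := G) h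
  have hF : F ∈ W1pSqrt γ p := (mem_domain_closure hc).2 ⟨G, h⟩
  exact ⟨hF, (closure_apply_eq_iff hc hF).2 h⟩

/-- The relation between the smooth gradients survives closure because a pointwise unitary operator
is continuous on `L^p`. -/
theorem nablaH_eq {p : ℝ≥0∞} [Fact (1 ≤ p)] {F : Lp ℝ p γ} (hF : F ∈ W1p γ p)
    (hF' : F ∈ W1pSqrt γ p) :
    nablaH γ p ⟨F, hF⟩ = isoLp p γ (cameronMartinIso hcent hnd) (daPratoM γ p ⟨F, hF'⟩) := by
  have h := (closure_apply_eq_iff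
    (fun (G : Lp X p γ) h => snd_eq_zero_of_mem_closure_smoothGraph hcent hnd p h) hF').1 rfl
  exact (closure_apply_eq_iff (snd_eq_zero_of_mem_closure_gradH hcent hnd p) hF).2
    (isoLp_mem_closure (isoLp_mem_smoothGraph hcent hnd) h)

theorem incl_nablaH_ae {p : ℝ≥0∞} [Fact (1 ≤ p)] {F : Lp ℝ p γ} (hF : F ∈ W1p γ p)
    (hF' : F ∈ W1pSqrt γ p) :
    ∀ᵐ x ∂γ, CameronMartin.incl γ (nablaH γ p ⟨F, hF⟩ x)
      = covSqrt γ (daPratoM γ p ⟨F, hF'⟩ x) := by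
  filter_upwards [coeFn_isoLp (cameronMartinIso hcent hnd) (daPratoM γ p ⟨F, hF'⟩)] with x hx
  rw [nablaH_eq hcent hnd hF hF', hx, incl_cameronMartinIso]

/-- White noise need not be bounded or smooth, but it is a polynomial of degree one, and for `p = 2`
the two graphs have the same closure. -/
theorem whiteNoise_mem_closure (z : X) :
    ((whiteNoise γ z : Lp ℝ 2 γ), Lp.const 2 γ z)
      ∈ (smoothGraph γ 2 (sqrtGradLin γ)).topologicalClosure := by
  rw [topologicalClosure_smoothGraph hcent hnd, ← topologicalClosure_polyGraph hcent hnd]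
  refine Submodule.le_topologicalClosure _ ⟨1, MvPolynomial.X 0, fun _ => z, ?_, ?_⟩
  · exact ae_of_all _ fun x => by simp [polyVar, whiteNoiseIso_apply]
  · filter_upwards [Lp.coeFn_const (p := 2) (μ := γ) z] with x hx
    rw [hx]
    simp [polyDeriv, polyVar]

/-- The integral is a value of a Gaussian characteristic function, hence an exponential. -/
theorem integral_cos_inner_ne_zero (w : X) : ∫ x, Real.cos (inner ℝ w x) ∂γ ≠ 0 := by
  have h := integral_cexp_gaussHilbert (whiteNoise γ (covSqrt γ w))
  have h1 : ∫ x, Complex.exp ((whiteNoise γ (covSqrt γ w) : Lp ℝ 2 γ) x * Complex.I) ∂γ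
      = ∫ x, Complex.exp ((inner ℝ w x : ℝ) * Complex.I) ∂γ := by
    refine integral_congr_ae ?_
    filter_upwards [whiteNoise_covSqrt_ae hcent hnd w] with x hx
    rw [hx]
  rw [h1] at h
  have hi := integrable_cexp_mul_I (P := γ) (F := fun x => inner ℝ w x) (by fun_prop)
  have h2 := congrArg Complex.reCLM h
  rw [← ContinuousLinearMap.integral_comp_comm _ hi] at h2
  simp only [Complex.reCLM_apply, Complex.exp_ofReal_mul_I_re] at h2
  rw [h2, ← Complex.ofReal_neg, ← Complex.ofReal_ofNat, ← Complex.ofReal_div,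
    Complex.exp_ofReal_re]
  exact Real.exp_ne_zero _

theorem exists_incl_nablaH_ne (p : ℝ≥0∞) [Fact (1 ≤ p)] (hX : ¬ FiniteDimensional ℝ X) :
    ∃ (F : Lp ℝ p γ) (hF : F ∈ W1p γ p) (hF' : F ∈ W1pSqrt γ p),
      ¬ ∀ᵐ x ∂γ, CameronMartin.incl γ (nablaH γ p ⟨F, hF⟩ x) = daPratoM γ p ⟨F, hF'⟩ x := by
  obtain ⟨w, hw⟩ := exists_covarianceOperator_ne (γ := γ) hX
  -- The phase makes `F` a sine, so that its derivative is `cos⟨w, x⟩ Q^{1/2} w`, whose scalar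
  -- factor has nonzero integral.
  have hf : MemLp (fun x => Real.cos (inner ℝ w x + -(Real.pi / 2))) p γ :=
    MemLp.of_bound (by fun_prop) 1 (ae_of_all _ fun _ => Real.abs_cos_le_one _)
  have hg : MemLp (fun x => Real.cos (inner ℝ w x) • covSqrt γ w) p γ :=
    MemLp.of_bound (by fun_prop) ‖covSqrt γ w‖ (ae_of_all _ fun _ => by
      rw [norm_smul]
      exact mul_le_of_le_one_left (norm_nonneg _) (Real.abs_cos_le_one _))
  have hmem : (hf.toLp _, hg.toLp _) ∈ (smoothGraph γ p (sqrtGradLin γ)).topologicalClosure := by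
    refine Submodule.le_topologicalClosure _
      ⟨⟨_, cos_inner_mem_Cb1 w (-(Real.pi / 2))⟩, hf.coeFn_toLp,
        hg.coeFn_toLp.trans (ae_of_all _ fun x => ?_)⟩
    have h := sqrtGrad_cos (γ := γ) w (-(Real.pi / 2)) x
    rw [neg_add_cancel, add_zero] at h
    exact h.symm
  obtain ⟨hF', hM⟩ := mem_W1pSqrt_of_mem_closure hcent hnd hmem
  have hF : hf.toLp _ ∈ W1p γ p := by rw [W1p_eq_W1pSqrt hcent hnd]; exact hF'
  refine ⟨_, hF, hF', fun hae => integral_cos_inner_ne_zero hcent hnd w ?_⟩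
  refine (integral_congr_ae ?_).trans (integral_zero X ℝ)
  filter_upwards [hae, incl_nablaH_ae hcent hnd hF hF', hg.coeFn_toLp] with x h1 h2 h3
  rw [h1, hM, h3, map_smul] at h2
  by_contra hc
  -- Where the cosine is nonzero, equality of the derivatives gives `Q^{1/2} w = Q w`; injectivity
  -- of `Q^{1/2}` then yields `w = Q^{1/2} w = Q w`.
  have h4 : covSqrt γ w = covSqrt γ (covSqrt γ w) := smul_right_injective X hc h2
  refine hw ?_
  rw [← covSqrt_covSqrt, ← h4]
  exact (covSqrt_injective hnd h4).symm

end Comparison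

/-! ### The theorem. -/

theorem mainTheorem12 {X : Type u} [NormedAddCommGroup X] [InnerProductSpace ℝ X]
    [CompleteSpace X] [SecondCountableTopology X] [MeasurableSpace X] [BorelSpace X]
    (γ : Measure X) [IsGaussian γ]
    (hcent : ∀ f : StrongDual ℝ X, ∫ x, f x ∂γ = 0)
    (hnd : LinearMap.ker (covarianceOperator γ).toLinearMap = ⊥) :
    -- equality of the norms of the two gradients of a `C^1` function
    (∀ φ : X → ℝ, ContDiff ℝ 1 φ → ∀ x, ‖gradH γ φ x‖ = ‖covSqrt γ (∇ φ x)‖) ∧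
    (∀ (p : ℝ≥0∞) [Fact (1 ≤ p)], p ≠ ∞ →
      -- the two operators are well defined on `C_b^1(X)` and closable
      (∀ φ ∈ Cb1 X, ∃ F : (nablaH₀ γ p).domain,
        (F : Lp ℝ p γ) =ᵐ[γ] φ ∧ nablaH₀ γ p F =ᵐ[γ] gradH γ φ) ∧
      (nablaH₀ γ p).IsClosable ∧
      (∀ φ ∈ Cb1 X, ∃ F : (sqrtGrad₀ γ p).domain,
        (F : Lp ℝ p γ) =ᵐ[γ] φ ∧ sqrtGrad₀ γ p F =ᵐ[γ] fun x => covSqrt γ (∇ φ x)) ∧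
      (sqrtGrad₀ γ p).IsClosable ∧
      -- their closures have the same domain, and `∇_H = Q^{1/2} M` there, with equal norms
      W1p γ p = W1pSqrt γ p ∧
      (∀ (F : Lp ℝ p γ) (hF : F ∈ W1p γ p) (hF' : F ∈ W1pSqrt γ p),
        (∀ᵐ x ∂γ, CameronMartin.incl γ (nablaH γ p ⟨F, hF⟩ x)
          = covSqrt γ (daPratoM γ p ⟨F, hF'⟩ x)) ∧
        ‖nablaH γ p ⟨F, hF⟩‖ = ‖daPratoM γ p ⟨F, hF'⟩‖) ∧
      -- the two derivatives are different
      (¬ FiniteDimensional ℝ X →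
        ∃ (F : Lp ℝ p γ) (hF : F ∈ W1p γ p) (hF' : F ∈ W1pSqrt γ p),
          ¬ ∀ᵐ x ∂γ, CameronMartin.incl γ (nablaH γ p ⟨F, hF⟩ x) = daPratoM γ p ⟨F, hF'⟩ x)) ∧
    -- for `p = 2` the common domain is the domain of every abstract Malliavin derivative
    (∀ (𝓗 : Type v) [NormedAddCommGroup 𝓗] [InnerProductSpace ℝ 𝓗] (W : 𝓗 ≃ₗᵢ[ℝ] gaussHilbert γ),
      (∀ (m : ℕ) (q : MvPolynomial (Fin m) ℝ) (h : Fin m → 𝓗),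
        ∃ F : (malliavinD₀ 2 W).domain,
          (F : Lp ℝ 2 γ) =ᵐ[γ] polyVar W q h ∧ malliavinD₀ 2 W F =ᵐ[γ] polyDeriv W q h) ∧
      (malliavinD₀ 2 W).IsClosable ∧
      D1p 2 W = W1p γ 2 ∧ D1p 2 W = W1pSqrt γ 2) ∧
    -- `∇_H ĥ = h` and `M 𝒲_z = z`
    (∀ h : CameronMartin γ, ∃ hd : (CameronMartin.hat γ h : Lp ℝ 2 γ) ∈ W1p γ 2,
      nablaH γ 2 ⟨_, hd⟩ = Lp.const 2 γ h) ∧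
    (∀ z : X, ∃ hd : (whiteNoise γ z : Lp ℝ 2 γ) ∈ W1pSqrt γ 2,
      daPratoM γ 2 ⟨_, hd⟩ = Lp.const 2 γ z) := by
  have hM : ∀ (p : ℝ≥0∞) [Fact (1 ≤ p)] (G : Lp X p γ),
      ((0 : Lp ℝ p γ), G) ∈ (smoothGraph γ p (sqrtGradLin γ)).topologicalClosure → G = 0 :=
    fun p _ _ h => snd_eq_zero_of_mem_closure_smoothGraph hcent hnd p h
  have hH : ∀ (p : ℝ≥0∞) [Fact (1 ≤ p)] (G : Lp (CameronMartin γ) p γ),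
      ((0 : Lp ℝ p γ), G) ∈ (smoothGraph γ p (gradHLin γ)).topologicalClosure → G = 0 :=
    fun p _ => snd_eq_zero_of_mem_closure_gradH hcent hnd p
  refine ⟨fun φ hφ x => ?_, fun p _ _ => ⟨fun φ hφ => ?_, ?_, fun φ hφ => ?_, ?_, ?_, ?_, ?_⟩,
    fun 𝓗 _ _ W => ⟨fun m q h => ?_, ?_, ?_, ?_⟩, fun h => ?_, fun z => ?_⟩
  · rw [gradH_eq hcent hnd (hφ.differentiable one_ne_zero x), LinearIsometryEquiv.norm_map]
  · obtain ⟨u, hu, hu1, hu2⟩ := exists_mem_smoothGraph_sqrtGrad (γ := γ) p hφ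
    obtain ⟨F, hF1, hF2⟩ := exists_domain_toLinearPMap (hH p)
      (isoLp_mem_smoothGraph hcent hnd u hu)
    refine ⟨F, by rw [hF1]; exact hu1, ?_⟩
    change (smoothGraph γ p (gradHLin γ)).toLinearPMap F =ᵐ[γ] _
    rw [hF2]
    filter_upwards [coeFn_isoLp (cameronMartinIso hcent hnd) u.2, hu2] with x h1 h2
    exact h1.trans ((congrArg _ h2).trans
      (gradH_eq hcent hnd (hφ.1.differentiable one_ne_zero x)).symm)
  · exact isClosable_toLinearPMap (hH p)
  · obtain ⟨u, hu, hu1, hu2⟩ := exists_mem_smoothGraph_sqrtGrad (γ := γ) p hφ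
    obtain ⟨F, hF1, hF2⟩ := exists_domain_toLinearPMap (hM p) hu
    refine ⟨F, by rw [hF1]; exact hu1, ?_⟩
    change (smoothGraph γ p (sqrtGradLin γ)).toLinearPMap F =ᵐ[γ] _
    rw [hF2]
    exact hu2
  · exact isClosable_toLinearPMap (hM p)
  · exact W1p_eq_W1pSqrt hcent hnd p
  · exact fun F hF hF' => ⟨incl_nablaH_ae hcent hnd hF hF', by
      rw [nablaH_eq hcent hnd hF hF', norm_isoLp]⟩
  · exact exists_incl_nablaH_ne hcent hnd p
  · obtain ⟨F, hF1, hF2⟩ := exists_domain_toLinearPMap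
      (snd_eq_zero_of_mem_closure_polyGraph hcent hnd W)
      (u := ((memLp_polyVar W q h).toLp _, (memLp_polyDeriv W q h).toLp _))
      ⟨m, q, h, (memLp_polyVar W q h).coeFn_toLp, (memLp_polyDeriv W q h).coeFn_toLp⟩
    refine ⟨F, by rw [hF1]; exact (memLp_polyVar W q h).coeFn_toLp, ?_⟩
    change (polyGraph 2 W).toLinearPMap F =ᵐ[γ] _
    rw [hF2]
    exact (memLp_polyDeriv W q h).coeFn_toLp
  · exact isClosable_toLinearPMap (snd_eq_zero_of_mem_closure_polyGraph hcent hnd W)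
  · rw [W1p_eq_W1pSqrt hcent hnd, D1p_eq_W1pSqrt hcent hnd]
  · exact D1p_eq_W1pSqrt hcent hnd W
  -- For `h` the image of `z`, the variable `ĥ` is `𝒲_z`, so the claim is the image of `M 𝒲_z = z`
  -- under the unitary operator.
  · obtain ⟨z, rfl⟩ := (cameronMartinIso hcent hnd).surjective h
    rw [hat_cameronMartinIso]
    obtain ⟨hF', hz⟩ := mem_W1pSqrt_of_mem_closure hcent hnd (whiteNoise_mem_closure hcent hnd z)
    have hF : (whiteNoise γ z : Lp ℝ 2 γ) ∈ W1p γ 2 := by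
      rw [W1p_eq_W1pSqrt hcent hnd]; exact hF'
    exact ⟨hF, by rw [nablaH_eq hcent hnd hF hF', hz, isoLp_const]⟩
  · exact mem_W1pSqrt_of_mem_closure hcent hnd (whiteNoise_mem_closure hcent hnd z)
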